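/- Let $a_1,\dots,a_4\in\mathbb R$ with $a_1a_4=a_2a_3$, and put $\alpha=-2\big((a_1-a_3)(2a_1+a_3)+(a_2-a_4)(2a_2+a_4)\big)$. Let $G=G(a_1,\dots,a_4)$ be a $6$-dimensional Lie group with a basis $e_1,\dots,e_5,A_2$ of the left-invariant $1$-forms such that $$\begin{aligned} de_1&=A_2\wedge e_2-(2a_1+a_3)\,e_3\wedge e_5-(2a_2+a_4)\,e_4\wedge e_5,\\ de_2&=-A_2\wedge e_1+(2a_1+a_3)\,e_4\wedge e_5-(2a_2+a_4)\,e_3\wedge e_5,\\ de_3&=-A_2\wedge e_4+(2a_1+a_3)\,e_1\wedge e_5+(2a_2+a_4)\,e_2\wedge e_5,\\ de_4&=A_2\wedge e_3-(2a_1+a_3)\,e_2\wedge e_5+(2a_2+a_4)\,e_1\wedge e_5,\\ de_5&=-2(a_1-a_3)(e_1\wedge e_3-e_2\wedge e_4)-2(a_2-a_4)(e_1\wedge e_4+e_2\wedge e_3),\\ dA_2&=\alpha\,(e_1\wedge e_2-e_3\wedge e_4). \end{aligned}$$ Let $M^5=M^5(a_1,\dots,a_4)$ be a non-empty (immersed)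 $5$-dimensional submanifold of $G$ on which the restrictions of $e_1,\dots,e_5$ are linearly independent at every point, with dual frame $E_1,\dots,E_5$. Equip $M^5$ with the almost contact metric structure $(g,\xi,\eta,\varphi)$ for which this (co)frame is adapted: $g=\sum_i e_i\otimes e_i$, $\eta=e_5$, $\xi=E_5$, and $\Phi(X,Y):=g(X,\varphi Y)$ equals $e_1\wedge e_2+e_3\wedge e_4$. Put $F=e_1\wedge e_2-e_3\wedge e_4$, $$N(X,Y,Z)=g\big(X,[\varphi Y,\varphi Z]+\varphi^2[Y,Z]-\varphi[\varphi Y,Z]-\varphi[Y,\varphi Z]\big)+\eta(X)\,d\eta(Y,Z),\qquad \gamma(X,Y)=d\Phi(\xi,\varphi X,Y),$$ and let $\nabla^g$ be the Levi-Civita connection. Then $M^5$ is a generalized quasi-Sasaki manifold, that is, an almost contact metric $5$-manifold such that $N(X,Y,Z)=0=d\Phi(X,Y,Z)$ for all $X,Y,Z$ orthogonal to $\xi$, and $\xi$ is a Killing vector field. The formula $$g(\nabla^c_XY,Z)=g(\nabla^g_XY,Z)+\tfrac12\big\{((d\eta-\gamma)\wedge\eta)(X,Y,Z)-N(X,Y,Z)\big\}$$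 defines a metric connection $\nabla^c$ with $\nabla^c\xi=0$, $\nabla^c\eta=0$, $\nabla^c\varphi=0$. Moreover: a) $N(\xi,X,Y)=2\,d\eta(X,Y)$. The tensor $N$ is totally skew-symmetric (i.e. $N(X,Y,Z)+N(Y,X,Z)=0$) if and only if $a_3=a_4=0$, and traceless cyclic (i.e. its cyclic sum vanishes and $\sum_iN(E_i,E_i,X)=0$) if and only if $a_1=a_2=0$. b) $dF=0$. c) The curvature $R^c(X,Y)=[\nabla^c_X,\nabla^c_Y]-\nabla^c_{[X,Y]}$ takes values in $\mathfrak u(2)$ (skew-symmetric endomorphisms that annihilate $\xi$ and commute with $\varphi$) and $R^c=\alpha\,F\otimes F$, i.e. $g(R^c(X,Y)Z,W)=\alpha\,F(X,Y)F(Z,W)$. As a map on $2$-forms, $R^c$ is $2\alpha$ times the orthogonal projection onto $\mathbb R F$. d) In the frame $E_1,\dots,E_5$ the Ricci tensor $\mathrm{Ric}^c(Y,Z)=\sum_ig(R^c(E_i,Y)Z,E_i)$ is $-\alpha\,\mathrm{diag}(1,1,1,1,0)$. e) In the spinor bundle (with fibre $\mathbb C^4$) of the spin structure determined by the global frame $E_1,\dots,E_5$,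 there exist two $\nabla^c$-parallel spinor fields, linearly independent at every point, that satisfy $F\cdot\Psi=0$ (Clifford product). -/

import Mathlib

open scoped Manifold ContDiff

noncomputable section

/-! ## Vector fields and differential forms on an `n`-dimensional manifold -/

/-- (Not necessarily smooth) vector fields on an `n`-dimensional manifold. -/
abbrev VField (n : ℕ) (M : Type*) [TopologicalSpace M]
    [ChartedSpace (EuclideanSpace ℝ (Fin n)) M] : Type _ :=
  (x : M) → TangentSpace (𝓡 n) x

/-- (Not necessarily smooth) `1`-forms on an `n`-dimensional manifold. -/
abbrev OneForm (n : ℕ) (M : Type*) [TopologicalSpace M]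
    [ChartedSpace (EuclideanSpace ℝ (Fin n)) M] : Type _ :=
  (x : M) → TangentSpace (𝓡 n) x →L[ℝ] ℝ

/-- Fields of bilinear forms on an `n`-dimensional manifold, such as metrics. -/
abbrev BilinField (n : ℕ) (M : Type*) [TopologicalSpace M]
    [ChartedSpace (EuclideanSpace ℝ (Fin n)) M] : Type _ :=
  (x : M) → TangentSpace (𝓡 n) x →L[ℝ] TangentSpace (𝓡 n) x →L[ℝ] ℝ

/-- `2`-forms on an `n`-dimensional manifold, given by their values on pairs of tangent vectors. -/
abbrev TwoForm (n : ℕ) (M : Type*) [TopologicalSpace M]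
    [ChartedSpace (EuclideanSpace ℝ (Fin n)) M] : Type _ :=
  (x : M) → TangentSpace (𝓡 n) x → TangentSpace (𝓡 n) x → ℝ

/-- Connections (covariant derivatives) on the tangent bundle. The vector `(∇_X Y)(x)` is
written `cov Y x (X x)`. -/
abbrev TangentConnection (n : ℕ) (M : Type*) [TopologicalSpace M]
    [ChartedSpace (EuclideanSpace ℝ (Fin n)) M] [IsManifold (𝓡 n) ∞ M] : Type _ :=
  CovariantDerivative (𝓡 n) (EuclideanSpace ℝ (Fin n)) (fun x : M => TangentSpace (𝓡 n) x)

section Forms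

variable {n : ℕ} {M : Type*} [TopologicalSpace M] [ChartedSpace (EuclideanSpace ℝ (Fin n)) M]

/-- The vector field `X` is smooth. -/
def SmoothField [IsManifold (𝓡 n) ∞ M] (X : VField n M) : Prop :=
  ContMDiff (𝓡 n) (𝓡 n).tangent ∞ (fun x => (⟨x, X x⟩ : TangentBundle (𝓡 n) M))

/-- The function `f` is smooth. -/
def SmoothFun (n : ℕ) {M : Type*} [TopologicalSpace M]
    [ChartedSpace (EuclideanSpace ℝ (Fin n)) M] (f : M → ℝ) : Prop :=
  ContMDiff (𝓡 n) 𝓘(ℝ, ℝ) ∞ f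

/-- The derivative `X(f)` of a function along a vector field. -/
def dirDeriv (X : VField n M) (f : M → ℝ) (x : M) : ℝ :=
  mvfderiv (𝓡 n) f x (X x)

/-- The Lie bracket `[X, Y]`. -/
def lieBr (X Y : VField n M) : VField n M :=
  VectorField.mlieBracket (𝓡 n) X Y

/-- The exterior derivative of a `1`-form:
`dσ(X,Y) = X(σ(Y)) - Y(σ(X)) - σ([X,Y])`. -/
def d1 (σ : OneForm n M) (X Y : VField n M) (x : M) : ℝ :=
  dirDeriv X (fun y => σ y (Y y)) x - dirDeriv Y (fun y => σ y (X y)) x - σ x (lieBr X Y x)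

/-- The exterior derivative of a `2`-form:
`dβ(X,Y,Z) = X(β(Y,Z)) - Y(β(X,Z)) + Z(β(X,Y)) - β([X,Y],Z) + β([X,Z],Y) - β([Y,Z],X)`. -/
def d2 (β : TwoForm n M) (X Y Z : VField n M) (x : M) : ℝ :=
  dirDeriv X (fun y => β y (Y y) (Z y)) x - dirDeriv Y (fun y => β y (X y) (Z y)) x
    + dirDeriv Z (fun y => β y (X y) (Y y)) x
    - β x (lieBr X Y x) (Z x) + β x (lieBr X Z x) (Y x) - β x (lieBr Y Z x) (X x)

/-- The wedge product of two `1`-forms: `(σ ∧ τ)(v,w) = σ(v) τ(w) - σ(w) τ(v)`. -/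
def wedge (σ τ : OneForm n M) : TwoForm n M := fun x v w => σ x v * τ x w - σ x w * τ x v

/-! ## Almost contact metric structures -/

/-- The data `(g, ξ, η, φ)` underlying an almost contact metric structure. -/
structure ACMData (n : ℕ) (M : Type*) [TopologicalSpace M]
    [ChartedSpace (EuclideanSpace ℝ (Fin n)) M] where
  /-- the metric -/
  g : BilinField n M
  /-- the distinguished vector field -/
  ξ : VField n M
  /-- the distinguished `1`-form -/
  η : OneForm n M
  /-- the endomorphism of the tangent bundle -/
  φ : (x : M) → TangentSpace (𝓡 n) x →L[ℝ] TangentSpace (𝓡 n) x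

namespace ACMData

variable (S : ACMData n M)

/-- The vector field `φ(X)`. -/
def ap (X : VField n M) : VField n M := fun x => S.φ x (X x)

/-- The function `g(X, Y)`. -/
def ip (X Y : VField n M) (x : M) : ℝ := S.g x (X x) (Y x)

/-- `(g, ξ, η, φ)` is an almost contact metric structure: `g` is a (smooth) Riemannian metric, `ξ`
a smooth vector field of length one, `η` its dual `1`-form and `φ` a smooth endomorphism of the
tangent bundle with `φ(ξ) = 0`, `φ² = -Id + η ⊗ ξ` and `g(φX, φY) = g(X,Y) - η(X)η(Y)`. -/
structure IsAlmostContactMetric [IsManifold (𝓡 n) ∞ M] : Prop where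
  g_symm : ∀ x v w, S.g x v w = S.g x w v
  g_pos : ∀ x v, v ≠ 0 → 0 < S.g x v v
  g_smooth : ∀ X Y : VField n M, SmoothField X → SmoothField Y → SmoothFun n (S.ip X Y)
  ξ_smooth : SmoothField S.ξ
  ξ_unit : ∀ x, S.g x (S.ξ x) (S.ξ x) = 1
  η_dual : ∀ x v, S.η x v = S.g x (S.ξ x) v
  φ_smooth : ∀ X : VField n M, SmoothField X → SmoothField (S.ap X)
  φ_ξ : ∀ x, S.φ x (S.ξ x) = 0
  φ_sq : ∀ x v, S.φ x (S.φ x v) = -v + S.η x v • S.ξ x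
  g_φ : ∀ x v w, S.g x (S.φ x v) (S.φ x w) = S.g x v w - S.η x v * S.η x w

/-- The fundamental form `Φ(X,Y) = g(X, φ(Y))`. -/
def fundForm : TwoForm n M := fun x v w => S.g x v (S.φ x w)

/-- The Nijenhuis torsion
`[φ,φ](X,Y) = [φX,φY] + φ²[X,Y] - φ[φX,Y] - φ[X,φY]`. -/
def nijenhuisTorsion (X Y : VField n M) : VField n M :=
  lieBr (S.ap X) (S.ap Y) + S.ap (S.ap (lieBr X Y))
    - S.ap (lieBr (S.ap X) Y) - S.ap (lieBr X (S.ap Y))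

/-- The Nijenhuis tensor `N(X,Y,Z) = g(X, [φ,φ](Y,Z)) + η(X) dη(Y,Z)`. -/
def nijenhuis (X Y Z : VField n M) (x : M) : ℝ :=
  S.ip X (S.nijenhuisTorsion Y Z) x + S.η x (X x) * d1 S.η Y Z x

/-- `ξ` is a Killing vector field: the Lie derivative of `g` along `ξ` vanishes. -/
def IsKillingField [IsManifold (𝓡 n) ∞ M] : Prop :=
  ∀ X Y : VField n M, SmoothField X → SmoothField Y → ∀ x,
    dirDeriv S.ξ (S.ip X Y) x - S.ip (lieBr S.ξ X) Y x - S.ip X (lieBr S.ξ Y) x = 0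

/-- Vector fields `E 0, …, E (n-1)` whose values at `x` form an orthonormal basis of the tangent
space at `x`. -/
def OrthonormalAt (E : Fin n → VField n M) (x : M) : Prop :=
  ∀ i j, S.g x (E i x) (E j x) = if i = j then 1 else 0

/-- A tensor `A ∈ Λ¹ ⊗ Λ²`, given by its values on vector fields, is totally skew-symmetric. -/
def IsTotallySkew [IsManifold (𝓡 n) ∞ M]
    (A : VField n M → VField n M → VField n M → M → ℝ) : Prop :=
  ∀ X Y Z : VField n M, SmoothField X → SmoothField Y → SmoothField Z → ∀ x,
    A X Y Z x + A Y X Z x = 0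

/-- A tensor `A ∈ Λ¹ ⊗ Λ²`, given by its values on vector fields, is traceless cyclic. -/
def IsTracelessCyclic [IsManifold (𝓡 n) ∞ M]
    (A : VField n M → VField n M → VField n M → M → ℝ) : Prop :=
  (∀ X Y Z : VField n M, SmoothField X → SmoothField Y → SmoothField Z → ∀ x,
    A X Y Z x + A Y Z X x + A Z X Y x = 0) ∧
  (∀ (E : Fin n → VField n M) (X : VField n M), (∀ i, SmoothField (E i)) → SmoothField X →
    ∀ x, S.OrthonormalAt E x → ∑ i, A (E i) (E i) X x = 0)

/-! ## Connections -/

section Connections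

variable [IsManifold (𝓡 n) ∞ M]

/-- The connection is metric: `X(g(Y,Z)) = g(∇_X Y, Z) + g(Y, ∇_X Z)`. -/
def IsMetricConnection (cov : TangentConnection n M) : Prop :=
  ∀ X Y Z : VField n M, SmoothField X → SmoothField Y → SmoothField Z → ∀ x,
    dirDeriv X (S.ip Y Z) x = S.g x (cov Y x (X x)) (Z x) + S.g x (Y x) (cov Z x (X x))

/-- The Levi-Civita connection `∇^g`: metric and torsion-free. -/
def IsLeviCivita (cov : TangentConnection n M) : Prop :=
  S.IsMetricConnection cov ∧
  ∀ X Y : VField n M, SmoothField X → SmoothField Y → ∀ x,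
    cov Y x (X x) - cov X x (Y x) = lieBr X Y x

/-- The connection is compatible with the almost contact metric structure:
`∇ξ = 0`, `∇η = 0`, `∇φ = 0`. -/
def IsCompatible (cov : TangentConnection n M) : Prop :=
  (∀ x (v : TangentSpace (𝓡 n) x), cov S.ξ x v = 0) ∧
  (∀ X Y : VField n M, SmoothField X → SmoothField Y → ∀ x,
    dirDeriv X (fun y => S.η y (Y y)) x - S.η x (cov Y x (X x)) = 0) ∧
  (∀ X Y : VField n M, SmoothField X → SmoothField Y → ∀ x,
    cov (S.ap Y) x (X x) - S.φ x (cov Y x (X x)) = 0)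

/-- `γ(X,Y) = dΦ(ξ, φ(X), Y)`. -/
def gammaForm (X Y : VField n M) (x : M) : ℝ := d2 S.fundForm S.ξ (S.ap X) Y x

/-- `A^c(X,Y,Z) = ½ { ((dη - γ) ∧ η)(X,Y,Z) - N(X,Y,Z) }`. -/
def canonicalTensor (X Y Z : VField n M) (x : M) : ℝ :=
  (1 / 2 : ℝ) *
    (((d1 S.η X Y x - S.gammaForm X Y x) * S.η x (Z x)
      - (d1 S.η X Z x - S.gammaForm X Z x) * S.η x (Y x)
      + (d1 S.η Y Z x - S.gammaForm Y Z x) * S.η x (X x))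
      - S.nijenhuis X Y Z x)

/-- `cov` is the canonical connection `∇^c` of the almost contact metric structure:
`g(∇^c_X Y, Z) = g(∇^g_X Y, Z) + A^c(X,Y,Z)`, where `∇^g` is the Levi-Civita connection. -/
def IsCanonicalConnection (cov : TangentConnection n M) : Prop :=
  ∃ lc : TangentConnection n M, S.IsLeviCivita lc ∧
    ∀ X Y Z : VField n M, SmoothField X → SmoothField Y → SmoothField Z → ∀ x,
      S.g x (cov Y x (X x)) (Z x) = S.g x (lc Y x (X x)) (Z x) + S.canonicalTensor X Y Z x

end Connections

/-- A *generalized quasi-Sasaki manifold*: an almost contact metric `5`-manifold such that `N` and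
`dΦ` vanish on vectors orthogonal to `ξ`, and `ξ` is a Killing vector field. -/
structure IsGeneralizedQuasiSasaki {M : Type*} [TopologicalSpace M]
    [ChartedSpace (EuclideanSpace ℝ (Fin 5)) M] [IsManifold (𝓡 5) ∞ M]
    (S : ACMData 5 M) : Prop where
  almostContactMetric : S.IsAlmostContactMetric
  nijenhuis_eq_zero : ∀ X Y Z : VField 5 M, SmoothField X → SmoothField Y → SmoothField Z →
    ∀ x, S.ip X S.ξ x = 0 → S.ip Y S.ξ x = 0 → S.ip Z S.ξ x = 0 → S.nijenhuis X Y Z x = 0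
  dΦ_eq_zero : ∀ X Y Z : VField 5 M, SmoothField X → SmoothField Y → SmoothField Z →
    ∀ x, S.ip X S.ξ x = 0 → S.ip Y S.ξ x = 0 → S.ip Z S.ξ x = 0 → d2 S.fundForm X Y Z x = 0
  killing : S.IsKillingField

end ACMData

/-! ## Curvature -/

section Curvature

variable [IsManifold (𝓡 n) ∞ M]

/-- The covariant derivative `∇_X Y` as a vector field. -/
def covAlong (cov : TangentConnection n M) (X Y : VField n M) : VField n M :=
  fun x => cov Y x (X x)

/-- The curvature `R(X,Y)Z = ∇_X ∇_Y Z - ∇_Y ∇_X Z - ∇_[X,Y] Z`. -/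
def curvature (cov : TangentConnection n M) (X Y Z : VField n M) : VField n M :=
  covAlong cov X (covAlong cov Y Z) - covAlong cov Y (covAlong cov X Z)
    - covAlong cov (lieBr X Y) Z

/-- The curvature as an operator on `2`-forms, computed in an orthonormal frame `E`:
`R(β)(Z,W) = ∑_{i<j} β(E_i,E_j) g(R(E_i,E_j)Z, W)`. -/
def curvatureOperator (S : ACMData n M) (E : Fin n → VField n M) (cov : TangentConnection n M)
    (β : TwoForm n M) (Z W : VField n M) (x : M) : ℝ :=
  ∑ i, ∑ j ∈ Finset.Ioi i, β x (E i x) (E j x) * S.ip (curvature cov (E i) (E j) Z) W x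

/-- The Ricci tensor `Ric(Y,Z) = ∑_i g(R(E_i,Y)Z, E_i)`, for an orthonormal frame `E`. -/
def ricci (S : ACMData n M) (E : Fin n → VField n M) (cov : TangentConnection n M)
    (Y Z : VField n M) (x : M) : ℝ :=
  ∑ i, S.ip (curvature cov (E i) Y Z) (E i) x

end Curvature

/-- The inner product `⟨β,β'⟩ = ∑_{i<j} β(E_i,E_j) β'(E_i,E_j)` of `2`-forms, for an orthonormal
frame `E`. -/
def formInner (E : Fin n → VField n M) (β β' : TwoForm n M) (x : M) : ℝ :=
  ∑ i, ∑ j ∈ Finset.Ioi i, β x (E i x) (E j x) * β' x (E i x) (E j x)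

end Forms

/-! ## Spinors in dimension five -/

/-- The quadratic form `v ↦ -(v₁² + … + v₅²)`, so that unit vectors square to `-1` in the
Clifford algebra. -/
def cliffordForm : QuadraticForm ℝ (Fin 5 → ℝ) :=
  QuadraticMap.weightedSumSquares ℝ (fun _ : Fin 5 => (-1 : ℝ))

/-- Four-dimensional complex representations of the Clifford algebra of Euclidean `ℝ⁵`, that is,
its irreducible complex representations; each of them restricts to the spin representation of
`Spin(5)`. -/
abbrev SpinRep : Type := CliffordAlgebra cliffordForm →ₐ[ℝ] Matrix (Fin 4) (Fin 4) ℂ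

/-- Clifford multiplication by the `i`-th vector of the standard basis. -/
def SpinRep.gen (ρ : SpinRep) (i : Fin 5) : Matrix (Fin 4) (Fin 4) ℂ :=
  ρ (CliffordAlgebra.ι cliffordForm (Pi.single i 1))

section Spinors

variable {M : Type*} [TopologicalSpace M] [ChartedSpace (EuclideanSpace ℝ (Fin 5)) M]

/-- An orthonormal frame `E` trivializes the frame bundle; in the corresponding (trivial) spin
structure, spinor fields are functions `M → ℂ⁴`. This is the Clifford product of a `2`-form and a
spinor field: `β · ψ = ∑_{i<j} β(E_i,E_j) e_i · e_j · ψ`. -/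
def cliffordMul (ρ : SpinRep) (E : Fin 5 → VField 5 M) (β : TwoForm 5 M)
    (ψ : M → (Fin 4 → ℂ)) (x : M) : Fin 4 → ℂ :=
  ∑ i, ∑ j ∈ Finset.Ioi i, β x (E i x) (E j x) • (ρ.gen i * ρ.gen j).mulVec (ψ x)

/-- The covariant derivative of spinor fields induced by a metric connection:
`∇_v ψ = dψ(v) + ½ ∑_{i<j} g(∇_v E_i, E_j) e_i · e_j · ψ`. -/
def spinDeriv [IsManifold (𝓡 5) ∞ M] (ρ : SpinRep) (S : ACMData 5 M) (E : Fin 5 → VField 5 M)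
    (cov : TangentConnection 5 M) (ψ : M → (Fin 4 → ℂ)) (x : M)
    (v : TangentSpace (𝓡 5) x) : Fin 4 → ℂ :=
  mvfderiv (𝓡 5) ψ x v + (1 / 2 : ℝ) •
    ∑ i, ∑ j ∈ Finset.Ioi i,
      S.g x (cov (E i) x v) (E j x) • (ρ.gen i * ρ.gen j).mulVec (ψ x)

/-- `ψ` is a smooth spinor field that is parallel with respect to the connection `cov`. -/
def IsParallelSpinor [IsManifold (𝓡 5) ∞ M] (ρ : SpinRep) (S : ACMData 5 M)
    (E : Fin 5 → VField 5 M) (cov : TangentConnection 5 M) (ψ : M → (Fin 4 → ℂ)) : Prop :=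
  ContMDiff (𝓡 5) 𝓘(ℝ, Fin 4 → ℂ) ∞ ψ ∧
    ∀ x (v : TangentSpace (𝓡 5) x), spinDeriv ρ S E cov ψ x v = 0

end Spinors

/-! ## The Lie groups `G(a₁,…,a₄)` and the manifolds `M⁵(a₁,…,a₄)` -/

section Family

/-- The constant `α = -2 ((a₁-a₃)(2a₁+a₃) + (a₂-a₄)(2a₂+a₄))`. -/
def alphaConst (a₁ a₂ a₃ a₄ : ℝ) : ℝ :=
  -2 * ((a₁ - a₃) * (2 * a₁ + a₃) + (a₂ - a₄) * (2 * a₂ + a₄))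

/-- The right-hand sides of the structure equations for `de₁, …, de₅, dA₂`, where
`θ 0, …, θ 4` are `e₁, …, e₅` and `θ 5` is `A₂`. -/
def structureForms {G : Type*} [TopologicalSpace G] [ChartedSpace (EuclideanSpace ℝ (Fin 6)) G]
    (a₁ a₂ a₃ a₄ : ℝ) (θ : Fin 6 → OneForm 6 G) : Fin 6 → TwoForm 6 G :=
  ![wedge (θ 5) (θ 1) - (2 * a₁ + a₃) • wedge (θ 2) (θ 4) - (2 * a₂ + a₄) • wedge (θ 3) (θ 4),
    -wedge (θ 5) (θ 0) + (2 * a₁ + a₃) • wedge (θ 3) (θ 4) - (2 * a₂ + a₄) • wedge (θ 2) (θ 4),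
    -wedge (θ 5) (θ 3) + (2 * a₁ + a₃) • wedge (θ 0) (θ 4) + (2 * a₂ + a₄) • wedge (θ 1) (θ 4),
    wedge (θ 5) (θ 2) - (2 * a₁ + a₃) • wedge (θ 1) (θ 4) + (2 * a₂ + a₄) • wedge (θ 0) (θ 4),
    (-2 * (a₁ - a₃)) • (wedge (θ 0) (θ 2) - wedge (θ 1) (θ 3))
      - (2 * (a₂ - a₄)) • (wedge (θ 0) (θ 3) + wedge (θ 1) (θ 2)),
    alphaConst a₁ a₂ a₃ a₄ • (wedge (θ 0) (θ 1) - wedge (θ 2) (θ 3))]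

/-- The `6`-dimensional Lie group `G` is a group `G(a₁,a₂,a₃,a₄)`, with the forms
`e₁, …, e₅, A₂ = θ 0, …, θ 5`: these are left-invariant `1`-forms, they form a basis of the
left-invariant `1`-forms, and they satisfy the structure equations. -/
structure IsStructureCoframe {G : Type*} [TopologicalSpace G]
    [ChartedSpace (EuclideanSpace ℝ (Fin 6)) G] [Group G] [LieGroup (𝓡 6) ∞ G]
    (a₁ a₂ a₃ a₄ : ℝ) (θ : Fin 6 → OneForm 6 G) : Prop where
  leftInvariant : ∀ (i : Fin 6) (h x : G) (v : TangentSpace (𝓡 6) x),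
    θ i (h * x) (mfderiv (𝓡 6) (𝓡 6) (fun y => h * y) x v) = θ i x v
  independent : ∀ x, LinearIndependent ℝ (fun i => θ i x)
  structure_eq : ∀ (i : Fin 6) (X Y : VField 6 G), SmoothField X → SmoothField Y → ∀ x,
    d1 (θ i) X Y x = structureForms a₁ a₂ a₃ a₄ θ i x (X x) (Y x)

/-- The restrictions of `e₁, …, e₅ = θ 0, …, θ 4` along `ι : M → G`. -/
def restrictedCoframe {G M : Type*} [TopologicalSpace G]
    [ChartedSpace (EuclideanSpace ℝ (Fin 6)) G] [TopologicalSpace M]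
    [ChartedSpace (EuclideanSpace ℝ (Fin 5)) M]
    (θ : Fin 6 → OneForm 6 G) (ι : M → G) : Fin 5 → OneForm 5 M :=
  fun i x => (θ i.castSucc (ι x)).comp (mfderiv (𝓡 5) (𝓡 6) ι x)

variable {M : Type*} [TopologicalSpace M] [ChartedSpace (EuclideanSpace ℝ (Fin 5)) M]

/-- The frame dual to a coframe `e`: the vector fields `E` with `e j (E i) = δ_ij`. -/
def dualFrame (e : Fin 5 → OneForm 5 M) : Fin 5 → VField 5 M := fun i x =>
  Function.invFun (fun (v : TangentSpace (𝓡 5) x) (j : Fin 5) => e j x v) (Pi.single i 1)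

/-- The almost contact metric structure for which the coframe `e` is adapted:
`g = ∑ e_i ⊗ e_i`, `η = e₅`, `ξ = E₅` and `Φ = e₁ ∧ e₂ + e₃ ∧ e₄`, i.e. (as `Φ(X,Y) = g(X, φY)`)
`φ = e₂ ⊗ E₁ - e₁ ⊗ E₂ + e₄ ⊗ E₃ - e₃ ⊗ E₄`. -/
def adaptedACM (e : Fin 5 → OneForm 5 M) : ACMData 5 M where
  g := fun x => ∑ i, (e i x).smulRight (e i x)
  ξ := dualFrame e 4
  η := e 4
  φ := fun x => (e 1 x).smulRight (dualFrame e 0 x) - (e 0 x).smulRight (dualFrame e 1 x)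
    + (e 3 x).smulRight (dualFrame e 2 x) - (e 2 x).smulRight (dualFrame e 3 x)

/-- The `2`-form `F = e₁ ∧ e₂ - e₃ ∧ e₄`. -/
def formF (e : Fin 5 → OneForm 5 M) : TwoForm 5 M :=
  wedge (e 0) (e 1) - wedge (e 2) (e 3)

end Family

end

/-! Everything rests on one formula for `∇^c` in the frame `E`. By the Koszul formula, the
Levi-Civita connection differs from componentwise differentiation by an algebraic expression in
`de_1, …, de_5`. Inserting the structure equations shows that the tensor defining `∇^c` cancels this
expression except for its `A_2` part (`canonicalTensor_eq`). Hence `g(∇^c_X Y, Z) = ∑ X(e_k(Y))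
e_k(Z) + A_2(X) F(Y,Z)`: the connection form of `∇^c` is `A_2 ⊗ F`, with values in the line spanned
by the constant matrix of `F`.

The claims on `∇^c` are read off from this. The matrix of `F` is skew, kills `ξ` and commutes with
`φ`, so `∇^c` preserves the structure. The line is an abelian Lie algebra, so the curvature is `dA_2
⊗ F = α F ⊗ F` (`coframe_curvature`), and `|F|² = 2` gives the factor of the projection. On spinors
the connection form acts as `½ A_2` times Clifford multiplication by `F`, so constant spinors in its
kernel are parallel. That kernel contains a plane because `e_1e_2` and `e_3e_4` are commuting square
roots of `-1` and `e_1` reverses the sign of the first only.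

The claims on `N`, `dΦ`, `dF` and `ξ` come from the same equations: each `de_k` determines the
`e_k`-component of a Lie bracket (`coframe_lieBr`). In `N` the combinations `2a_1+a_3`, `a_1-a_3`
(likewise with indices 2, 4) meet so that the symmetric defect is a multiple of `a_3, a_4` and the
cyclic sum a multiple of `a_1, a_2`.

The analytic input is the restriction of the structure equations from `G` to `M`
(`d1_pullbackForm`), which rests on the bracket being the commutator of derivations
(`dirDeriv_lieBr`). -/

noncomputable section

/-! ### Directional derivatives and the Lie bracket as a commutator. -/

section Calculus

variable {n : ℕ} {M : Type*} [TopologicalSpace M] [ChartedSpace (EuclideanSpace ℝ (Fin n)) M]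

lemma dirDeriv_const (X : VField n M) (c : ℝ) (x : M) : dirDeriv X (fun _ => c) x = 0 := by
  simp [dirDeriv, mvfderiv_const]

lemma dirDeriv_add {f g : M → ℝ} {x : M} (X : VField n M)
    (hf : MDifferentiableAt (𝓡 n) 𝓘(ℝ, ℝ) f x) (hg : MDifferentiableAt (𝓡 n) 𝓘(ℝ, ℝ) g x) :
    dirDeriv X (fun y => f y + g y) x = dirDeriv X f x + dirDeriv X g x := by
  simp [dirDeriv, mvfderiv_fun_add hf hg]

lemma dirDeriv_sub {f g : M → ℝ} {x : M} (X : VField n M)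
    (hf : MDifferentiableAt (𝓡 n) 𝓘(ℝ, ℝ) f x) (hg : MDifferentiableAt (𝓡 n) 𝓘(ℝ, ℝ) g x) :
    dirDeriv X (fun y => f y - g y) x = dirDeriv X f x - dirDeriv X g x := by
  simp [dirDeriv, mvfderiv_fun_sub hf hg]

lemma dirDeriv_neg {f : M → ℝ} {x : M} (X : VField n M) :
    dirDeriv X (fun y => - f y) x = - dirDeriv X f x := by
  simp [dirDeriv, mvfderiv_fun_neg]

lemma dirDeriv_mul {f g : M → ℝ} {x : M} (X : VField n M)
    (hf : MDifferentiableAt (𝓡 n) 𝓘(ℝ, ℝ) f x) (hg : MDifferentiableAt (𝓡 n) 𝓘(ℝ, ℝ) g x) :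
    dirDeriv X (fun y => f y * g y) x = f x * dirDeriv X g x + dirDeriv X f x * g x := by
  simp only [dirDeriv, mvfderiv_fun_mul hf hg]
  simp [mul_comm]

lemma dirDeriv_sum {κ : Type} (s : Finset κ) {f : κ → M → ℝ} {x : M} (X : VField n M)
    (hf : ∀ i ∈ s, MDifferentiableAt (𝓡 n) 𝓘(ℝ, ℝ) (f i) x) :
    dirDeriv X (fun y => ∑ i ∈ s, f i y) x = ∑ i ∈ s, dirDeriv X (f i) x := by
  classical
  induction s using Finset.induction_on with
  | empty => simp [dirDeriv_const]
  | insert a s ha ih =>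
    simp only [Finset.sum_insert ha]
    rw [dirDeriv_add X (hf a (by simp)), ih fun i hi => hf i (by simp [hi])]
    have h : MDifferentiableAt (𝓡 n) 𝓘(ℝ, ℝ) (∑ i ∈ s, f i) x :=
      MDifferentiableAt.sum fun i hi => hf i (by simp [hi])
    simpa only [Finset.sum_fn] using h

lemma Filter.EventuallyEq.dirDeriv_eq {f g : M → ℝ} {x : M} (h : f =ᶠ[nhds x] g) (X : VField n M) :
    dirDeriv X f x = dirDeriv X g x := by
  simp only [dirDeriv, mvfderiv, h.mfderiv_eq]
  rfl

lemma SmoothFun.mdifferentiableAt {f : M → ℝ} (hf : SmoothFun n f) (x : M) :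
    MDifferentiableAt (𝓡 n) 𝓘(ℝ, ℝ) f x :=
  (hf x).mdifferentiableAt (by simp)

variable [IsManifold (𝓡 n) ∞ M]

/-- The vector field `X` is smooth at the point `x`. -/
def SmoothFieldAt (X : VField n M) (x : M) : Prop :=
  ContMDiffAt (𝓡 n) (𝓡 n).tangent ∞ (fun x => (⟨x, X x⟩ : TangentBundle (𝓡 n) M)) x

lemma SmoothField.at {X : VField n M} (hX : SmoothField X) (x : M) : SmoothFieldAt X x := hX x

lemma ContMDiffAt.dirDeriv {f : M → ℝ} {X : VField n M} {x : M}
    (hf : ContMDiffAt (𝓡 n) 𝓘(ℝ, ℝ) ∞ f x) (hX : SmoothFieldAt X x) :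
    ContMDiffAt (𝓡 n) 𝓘(ℝ, ℝ) ∞ (dirDeriv X f) x := by
  have h1 := hf.mfderiv_const (m := ∞) (by simp)
  have h2 := ContMDiffAt.clm_apply_of_inCoordinates (E₁ := fun x : M => TangentSpace (𝓡 n) x)
    (E₂ := fun x : ℝ => TangentSpace 𝓘(ℝ, ℝ) x) (b₁ := id) (b₂ := f) h1 hX hf
  rw [Bundle.contMDiffAt_totalSpace] at h2
  refine h2.2.congr_of_eventuallyEq (.of_forall fun y => ?_)
  simp [_root_.dirDeriv, mvfderiv]
  rfl

lemma SmoothFun.dirDeriv {f : M → ℝ} {X : VField n M} (hf : SmoothFun n f) (hX : SmoothField X) :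
    SmoothFun n (dirDeriv X f) := fun x => (hf x).dirDeriv (hX x)

/-- Provides the test field in `dirDeriv_lieBr`: an identity between functions is proved there as an
identity between multiples of `Z x`. -/
lemma exists_smoothFieldAt_ne_zero [NeZero n] (x : M) :
    ∃ Z : VField n M, SmoothFieldAt Z x ∧ Z x ≠ 0 := by
  let b := (EuclideanSpace.basisFun (Fin n) ℝ).toBasis
  let t := trivializationAt (EuclideanSpace ℝ (Fin n)) (TangentSpace (𝓡 n) : M → Type _) x
  have hx : x ∈ t.baseSet := FiberBundle.mem_baseSet_trivializationAt' x
  refine ⟨t.localFrame b 0, contMDiffAt_localFrame_of_mem ∞ t b 0 hx, ?_⟩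
  rw [t.localFrame_apply_of_mem_baseSet b hx]
  exact (t.basisAt b hx).ne_zero 0

/-- The bracket of vector fields is the commutator of derivations. -/
theorem dirDeriv_lieBr [NeZero n] {X Y : VField n M} {f : M → ℝ} {x : M}
    (hX : SmoothFieldAt X x) (hY : SmoothFieldAt Y x) (hf : ContMDiffAt (𝓡 n) 𝓘(ℝ, ℝ) ∞ f x) :
    dirDeriv (lieBr X Y) f x = dirDeriv X (dirDeriv Y f) x - dirDeriv Y (dirDeriv X f) x := by
  obtain ⟨Z, hZ, hZ0⟩ := exists_smoothFieldAt_ne_zero (n := n) x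
  have h3 : (3 : ℕ∞ω) ≤ ∞ := WithTop.coe_le_coe.mpr le_top
  have h2 : minSmoothness ℝ 2 ≤ (∞ : ℕ∞ω) := by
    simpa using (show (2 : ℕ∞ω) ≤ ∞ from WithTop.coe_le_coe.mpr le_top)
  have : IsManifold (𝓡 n) (minSmoothness ℝ 3) M := IsManifold.of_le (n := ∞) (by simpa using h3)
  have : IsManifold (𝓡 n) (∞ + 1) M := IsManifold.of_le (n := ∞) (by simp)
  have md : ∀ {U : VField n M} {y : M},
      ContMDiffAt (𝓡 n) (𝓡 n).tangent 1 (fun x => (⟨x, U x⟩ : TangentBundle (𝓡 n) M)) y →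
      MDifferentiableAt (𝓡 n) (𝓡 n).tangent
        (fun x => (⟨x, U x⟩ : TangentBundle (𝓡 n) M)) y := fun h => h.mdifferentiableAt (by simp)
  have le1 : (1 : ℕ∞ω) ≤ ∞ := by simp
  have sm : ∀ {g : M → ℝ} {U : VField n M}, ContMDiffAt (𝓡 n) 𝓘(ℝ, ℝ) ∞ g x →
      SmoothFieldAt U x → SmoothFieldAt (g • U) x := fun hg hU => hg.smul_section hU
  have br : ∀ {U W : VField n M}, SmoothFieldAt U x → SmoothFieldAt W x →
      SmoothFieldAt (VectorField.mlieBracket (𝓡 n) U W) x := by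
    intro U W hU hW
    exact ContMDiffAt.mlieBracket_vectorField (m := ⊤) (n := ⊤) hU hW (by simp)
  -- The Leibniz rule for `[U, fZ]` is needed as an equality of germs, since the result is bracketed
  -- once more.
  have prod : ∀ {U : VField n M},
      VectorField.mlieBracket (𝓡 n) U (f • Z) =ᶠ[nhds x]
        (dirDeriv U f) • Z + f • VectorField.mlieBracket (𝓡 n) U Z := by
    intro U
    have hf1 := (contMDiffAt_iff_contMDiffAt_nhds (by simp)).mp (hf.of_le le1)
    have hZ1 := (contMDiffAt_iff_contMDiffAt_nhds (by simp)).mp (hZ.of_le le1)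
    filter_upwards [hf1, hZ1] with y hfy hZy
    exact VectorField.mlieBracket_smul_right (hfy.mdifferentiableAt (by simp)) (md hZy)
  have second : ∀ {U W : VField n M}, SmoothFieldAt U x → SmoothFieldAt W x →
      VectorField.mlieBracket (𝓡 n) U (VectorField.mlieBracket (𝓡 n) W (f • Z)) x =
        dirDeriv U (dirDeriv W f) x • Z x + dirDeriv W f x • VectorField.mlieBracket (𝓡 n) U Z x
        + (dirDeriv U f x • VectorField.mlieBracket (𝓡 n) W Z x
          + f x • VectorField.mlieBracket (𝓡 n) U (VectorField.mlieBracket (𝓡 n) W Z) x) := by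
    intro U W hU hW
    rw [Filter.EventuallyEq.mlieBracket_vectorField_eq (Filter.EventuallyEq.refl _ U) prod,
      VectorField.mlieBracket_add_right (md ((sm (hf.dirDeriv hW) hZ).of_le le1))
        (md ((sm hf (br hW hZ)).of_le le1)),
      VectorField.mlieBracket_smul_right ((hf.dirDeriv hW).mdifferentiableAt (by simp))
        (md (hZ.of_le le1)),
      VectorField.mlieBracket_smul_right (hf.mdifferentiableAt (by simp))
        (md ((br hW hZ).of_le le1))]
    rfl
  -- The Jacobi identity for `X, Y, fZ` minus `f` times the one for `X, Y, Z`: the terms with a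
  -- single derivative of `f` along `X` or `Y` cancel, and `([X,Y]f - X(Yf) + Y(Xf)) Z = 0` remains.
  have J := VectorField.leibniz_identity_mlieBracket_apply (hX.of_le h2) (hY.of_le h2)
    ((sm hf hZ).of_le h2)
  have J' := VectorField.leibniz_identity_mlieBracket_apply (hX.of_le h2) (hY.of_le h2)
    (hZ.of_le h2)
  rw [second hX hY, second hY hX, prod.self_of_nhds, J'] at J
  have key : (dirDeriv (lieBr X Y) f x
      - (dirDeriv X (dirDeriv Y f) x - dirDeriv Y (dirDeriv X f) x)) • Z x = 0 := by
    simp only [Pi.add_apply, Pi.smul_apply'] at J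
    have J2 := sub_eq_zero.mpr J
    refine Eq.trans ?_ (neg_eq_zero.mpr J2)
    simp only [lieBr, smul_add]
    module
  exact sub_eq_zero.mp ((smul_eq_zero.mp key).resolve_right hZ0)

end Calculus

/-! ### Dual bases. -/

section LinearAlgebra

variable {n : ℕ} {V : Type*} [AddCommGroup V] [Module ℝ V] [TopologicalSpace V]
  [FiniteDimensional ℝ V]

lemma eq_sum_of_dual (hn : Module.finrank ℝ V = n) {θ : Fin n → V →L[ℝ] ℝ} {b : Fin n → V}
    (h : ∀ i j, θ i (b j) = if i = j then 1 else 0) (v : V) : v = ∑ j, θ j v • b j := by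
  have li : LinearIndependent ℝ b := by
    rw [Fintype.linearIndependent_iff]
    intro g hg i
    have := congrArg (θ i) hg
    simpa [h] using this
  let B := basisOfLinearIndependentOfCardEqFinrank' b li (by simp [hn])
  have hB : ∀ j, B j = b j := fun j => by simp [B]
  have h2 := B.sum_repr v
  have h3 : ∀ i, θ i v = B.repr v i := by
    intro i
    conv_lhs => rw [← h2]
    simp [hB, h]
  simp only [h3]
  simpa [hB] using h2.symm

lemma bijective_of_linearIndependent (hn : Module.finrank ℝ V = n) {θ : Fin n → V →L[ℝ] ℝ}
    (h : LinearIndependent ℝ θ) : Function.Bijective (fun (v : V) (j : Fin n) => θ j v) := by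
  let Θ : V →ₗ[ℝ] (Fin n → ℝ) := LinearMap.pi fun j => (θ j : V →ₗ[ℝ] ℝ)
  have h' : LinearIndependent ℝ (fun j => (θ j : V →ₗ[ℝ] ℝ)) := by
    rw [Fintype.linearIndependent_iff] at h ⊢
    intro g hg
    refine h g ?_
    ext v
    simpa using LinearMap.congr_fun hg v
  have hspan := h'.span_eq_top_of_card_eq_finrank' (by
    rw [Fintype.card_fin]; exact (hn.symm.trans (Subspace.dual_finrank_eq).symm))
  have inj : Function.Injective Θ := by
    rw [injective_iff_map_eq_zero]
    intro v hv
    refine (Module.forall_dual_apply_eq_zero_iff ℝ v).mp fun f => ?_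
    have hf : f ∈ Submodule.span ℝ (Set.range fun j => (θ j : V →ₗ[ℝ] ℝ)) := by
      rw [hspan]; trivial
    induction hf using Submodule.span_induction with
    | mem g hg => obtain ⟨j, rfl⟩ := hg; exact congrFun hv j
    | zero => simp
    | add f g _ _ hf hg => simp [hf, hg]
    | smul c f _ hf => simp [hf]
  exact ⟨inj, (LinearMap.injective_iff_surjective_of_finrank_eq_finrank (by simp [hn])).mp inj⟩

end LinearAlgebra

/-! ### Smoothness of the inverse matrix. -/

section MatrixInverse

variable {n : ℕ} {M : Type*} [TopologicalSpace M] [ChartedSpace (EuclideanSpace ℝ (Fin n)) M]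
  {m : ℕ} {B : M → Matrix (Fin m) (Fin m) ℝ} {x : M}

lemma ContMDiffAt.matrix_det (hB : ∀ i j, ContMDiffAt (𝓡 n) 𝓘(ℝ, ℝ) ∞ (fun y => B y i j) x) :
    ContMDiffAt (𝓡 n) 𝓘(ℝ, ℝ) ∞ (fun y => (B y).det) x := by
  simp only [Matrix.det_apply']
  refine ContMDiffAt.sum fun σ _ => contMDiffAt_const.mul ?_
  exact contMDiffAt_finsetProd fun i _ => hB _ _

/-- Cramer's rule: the entries of the adjugate are determinants of matrices in which one row has
been replaced by a constant one. -/
lemma ContMDiffAt.matrix_inv (hB : ∀ i j, ContMDiffAt (𝓡 n) 𝓘(ℝ, ℝ) ∞ (fun y => B y i j) x)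
    (hdet : (B x).det ≠ 0) (i j : Fin m) :
    ContMDiffAt (𝓡 n) 𝓘(ℝ, ℝ) ∞ (fun y => (B y)⁻¹ i j) x := by
  simp only [Matrix.inv_def, Ring.inverse_eq_inv', Matrix.smul_apply, smul_eq_mul]
  refine ((ContMDiffAt.matrix_det hB).inv₀ hdet).mul ?_
  simp only [Matrix.adjugate_apply]
  refine ContMDiffAt.matrix_det fun k l => ?_
  by_cases hk : k = j
  · subst hk
    simp only [Matrix.updateRow_self]
    exact contMDiffAt_const
  · simp only [Matrix.updateRow_ne hk]
    exact hB k l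

end MatrixInverse

/-! ### Smoothness of dual frames and coframes. -/

section Frames

variable {n : ℕ} {N : Type*} [TopologicalSpace N] [ChartedSpace (EuclideanSpace ℝ (Fin n)) N]

instance (x : N) : FiniteDimensional ℝ (TangentSpace (𝓡 n) x) :=
  inferInstanceAs (FiniteDimensional ℝ (EuclideanSpace ℝ (Fin n)))

lemma finrank_tangentSpace (x : N) : Module.finrank ℝ (TangentSpace (𝓡 n) x) = n :=
  (finrank_euclideanSpace_fin : Module.finrank ℝ (EuclideanSpace ℝ (Fin n)) = n)

/-- The forms `θ` and the vector fields `V` are pointwise dual to each other. -/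
def IsDualPair (θ : Fin n → OneForm n N) (V : Fin n → VField n N) : Prop :=
  ∀ x i j, θ i x (V j x) = if i = j then 1 else 0

lemma IsDualPair.eq_sum {θ : Fin n → OneForm n N} {V : Fin n → VField n N} (h : IsDualPair θ V)
    (x : N) (v : TangentSpace (𝓡 n) x) : v = ∑ j, θ j x v • V j x :=
  eq_sum_of_dual (finrank_tangentSpace x) (h x) v

lemma IsDualPair.vec_ext {e : Fin n → OneForm n N} {E : Fin n → VField n N} (h : IsDualPair e E)
    {x : N} {v w : TangentSpace (𝓡 n) x} (hvw : ∀ k, e k x v = e k x w) : v = w := by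
  rw [h.eq_sum x v, h.eq_sum x w]
  simp only [hvw]

variable [IsManifold (𝓡 n) ∞ N]

/-- The forms dual to a smooth frame are smooth along maps. -/
lemma IsDualPair.contMDiffAt_coeff {θ : Fin n → OneForm n N} {V : Fin n → VField n N}
    (h : IsDualPair θ V) (hV : ∀ i, SmoothField (V i)) {m : ℕ} {M : Type*} [TopologicalSpace M]
    [ChartedSpace (EuclideanSpace ℝ (Fin m)) M] {b : M → N}
    {w : (y : M) → TangentSpace (𝓡 n) (b y)} {y₀ : M}
    (hw : ContMDiffAt (𝓡 m) (𝓡 n).tangent ∞ (fun y => (⟨b y, w y⟩ : TangentBundle (𝓡 n) N)) y₀)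
    (i : Fin n) : ContMDiffAt (𝓡 m) 𝓘(ℝ, ℝ) ∞ (fun y => θ i (b y) (w y)) y₀ := by
  let T := trivializationAt (EuclideanSpace ℝ (Fin n)) (TangentSpace (𝓡 n) : N → Type _) (b y₀)
  have hb : b y₀ ∈ T.baseSet := FiberBundle.mem_baseSet_trivializationAt' (b y₀)
  obtain ⟨hb', hc⟩ := Bundle.contMDiffAt_totalSpace.mp hw
  -- The columns of `B` are the coordinates of the frame in a trivialization, so the coefficients `θ
  -- j (w)` solve a linear system with matrix `B` and the coordinates of `w` as right-hand side.
  let B : M → Matrix (Fin n) (Fin n) ℝ := fun y => Matrix.of fun a j => (T ⟨b y, V j (b y)⟩).2 a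
  have hB : ∀ a j, ContMDiffAt (𝓡 m) 𝓘(ℝ, ℝ) ∞ (fun y => B y a j) y₀ := by
    intro a j
    have h1 := (Bundle.contMDiffAt_totalSpace.mp (hV j (b y₀))).2
    have h2 := h1.comp y₀ hb'
    exact (contDiff_euclidean.mp contDiff_id a).contMDiff.contMDiffAt.comp y₀ h2
  have hmul : ∀ y, b y ∈ T.baseSet → ∀ v : TangentSpace (𝓡 n) (b y),
      (B y).mulVec (fun j => θ j (b y) v) = fun a => (T ⟨b y, v⟩).2 a := by
    intro y hy v
    have hlin : ∀ v : TangentSpace (𝓡 n) (b y), (T ⟨b y, v⟩).2 = T.linearEquivAt ℝ (b y) hy v :=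
      fun v => by simp
    ext a
    conv_rhs => rw [h.eq_sum (b y) v, hlin]
    simp [B, Matrix.mulVec, dotProduct, mul_comm]
  have hunit : ∀ y, b y ∈ T.baseSet → IsUnit (B y) := by
    intro y hy
    refine Matrix.mulVec_surjective_iff_isUnit.mp fun k =>
      ⟨_, (hmul y hy ((T.linearEquivAt ℝ (b y) hy).symm (WithLp.toLp 2 k))).trans ?_⟩
    ext a
    have := (T.linearEquivAt ℝ (b y) hy).apply_symm_apply (WithLp.toLp 2 k)
    simp only [Bundle.Trivialization.linearEquivAt_apply] at this
    rw [this]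
  have hev : ∀ᶠ y in nhds y₀, b y ∈ T.baseSet :=
    hb'.continuousAt.eventually_mem (T.open_baseSet.mem_nhds hb)
  have hfin : ContMDiffAt (𝓡 m) 𝓘(ℝ, ℝ) ∞
      (fun y => ∑ a, (B y)⁻¹ i a * (T ⟨b y, w y⟩).2 a) y₀ := by
    refine ContMDiffAt.sum fun a _ => ?_
    refine (ContMDiffAt.matrix_inv hB ?_ i a).mul ?_
    · exact ((Matrix.isUnit_iff_isUnit_det _).mp (hunit y₀ hb)).ne_zero
    · exact (contDiff_euclidean.mp contDiff_id a).contMDiff.contMDiffAt.comp y₀ hc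
  refine hfin.congr_of_eventuallyEq ?_
  filter_upwards [hev] with y hy
  have h1 := congrArg ((B y)⁻¹.mulVec) (hmul y hy (w y))
  rw [Matrix.mulVec_mulVec, Matrix.nonsing_inv_mul _ ((Matrix.isUnit_iff_isUnit_det _).mp (hunit y hy)),
    Matrix.one_mulVec] at h1
  exact congrFun h1 i

/-- The frame dual to a smooth coframe is smooth. -/
lemma IsDualPair.smoothField {e : Fin n → OneForm n N} {E : Fin n → VField n N}
    (h : IsDualPair e E)
    (he : ∀ i x (Y : VField n N), SmoothFieldAt Y x →
      ContMDiffAt (𝓡 n) 𝓘(ℝ, ℝ) ∞ (fun y => e i y (Y y)) x) (j : Fin n) : SmoothField (E j) := by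
  intro x
  let b := (EuclideanSpace.basisFun (Fin n) ℝ).toBasis
  let t := trivializationAt (EuclideanSpace ℝ (Fin n)) (TangentSpace (𝓡 n) : N → Type _) x
  have hx : x ∈ t.baseSet := FiberBundle.mem_baseSet_trivializationAt' x
  have hL : ∀ a, SmoothFieldAt (t.localFrame b a) x := fun a =>
    contMDiffAt_localFrame_of_mem ∞ t b a hx
  -- The transposed situation: `C` evaluates the forms on a smooth local frame, and column `j` of
  -- its inverse holds the components of `E j`.
  let C : N → Matrix (Fin n) (Fin n) ℝ := fun y => Matrix.of fun i a => e i y (t.localFrame b a y)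
  have hC : ∀ i a, ContMDiffAt (𝓡 n) 𝓘(ℝ, ℝ) ∞ (fun y => C y i a) x := fun i a => he i x _ (hL a)
  have hmul : ∀ y (hy : y ∈ t.baseSet) (v : TangentSpace (𝓡 n) y),
      (C y).mulVec (fun a => (t.basisAt b hy).repr v a) = fun i => e i y v := by
    intro y hy v
    ext i
    have hv := congrArg (e i y) ((t.basisAt b hy).sum_repr v)
    rw [map_sum] at hv
    rw [← hv]
    simp [C, Matrix.mulVec, dotProduct, t.localFrame_apply_of_mem_baseSet b hy, mul_comm]
  have hunit : ∀ y, y ∈ t.baseSet → IsUnit (C y) := by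
    intro y hy
    refine Matrix.mulVec_surjective_iff_isUnit.mp fun k => ⟨_, (hmul y hy (∑ j, k j • E j y)).trans ?_⟩
    ext i
    simp [h y i]
  have hfin : SmoothFieldAt (fun y => ∑ a, (C y)⁻¹ a j • t.localFrame b a y) x :=
    ContMDiffAt.sum_section fun a _ => (ContMDiffAt.matrix_inv hC
      ((Matrix.isUnit_iff_isUnit_det _).mp (hunit x hx)).ne_zero a j).smul_section (hL a)
  refine hfin.congr_of_eventuallyEq ?_
  filter_upwards [t.open_baseSet.mem_nhds hx] with y hy
  have h1 := congrArg ((C y)⁻¹.mulVec) (hmul y hy (E j y))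
  rw [Matrix.mulVec_mulVec, Matrix.nonsing_inv_mul _ ((Matrix.isUnit_iff_isUnit_det _).mp (hunit y hy)),
    Matrix.one_mulVec] at h1
  have h2 : ∀ a, (t.basisAt b hy).repr (E j y) a = (C y)⁻¹ a j := fun a => by
    rw [congrFun h1 a]
    simp [Matrix.mulVec, dotProduct, h y]
  congr 1
  conv_lhs => rw [← (t.basisAt b hy).sum_repr (E j y)]
  simp [h2, t.localFrame_apply_of_mem_baseSet b hy]

end Frames

/-! ### Left-invariant vector fields. -/

section LeftInvariant

variable {n : ℕ} {G : Type*} [TopologicalSpace G] [ChartedSpace (EuclideanSpace ℝ (Fin n)) G]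
  [Group G] [LieGroup (𝓡 n) ∞ G]

/-- The field is the tangent map of the multiplication `G × G → G` applied to the pair consisting of
the zero vector at `g` and `v` at `1`; it is thus a composition of smooth maps. -/
lemma smoothField_mulInvariantVectorField (v : GroupLieAlgebra (𝓡 n) G) :
    SmoothField (M := G) (mulInvariantVectorField v) := by
  let fg : G → TangentBundle (𝓡 n) G := fun g => ⟨g, 0⟩
  have sfg : ContMDiff (𝓡 n) (𝓡 n).tangent ∞ fg := Bundle.contMDiff_zeroSection _ _
  let fv : G → TangentBundle (𝓡 n) G := fun _ => ⟨1, v⟩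
  have sfv : ContMDiff (𝓡 n) (𝓡 n).tangent ∞ fv := contMDiff_const
  let F₁ : G → (TangentBundle (𝓡 n) G × TangentBundle (𝓡 n) G) := fun g => (fg g, fv g)
  have S₁ : ContMDiff (𝓡 n) ((𝓡 n).tangent.prod (𝓡 n).tangent) ∞ F₁ := sfg.prodMk sfv
  let F₂ : (TangentBundle (𝓡 n) G × TangentBundle (𝓡 n) G) →
      TangentBundle ((𝓡 n).prod (𝓡 n)) (G × G) := (equivTangentBundleProd (𝓡 n) G (𝓡 n) G).symm
  have S₂ : ContMDiff ((𝓡 n).tangent.prod (𝓡 n).tangent) ((𝓡 n).prod (𝓡 n)).tangent ∞ F₂ :=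
    contMDiff_equivTangentBundleProd_symm
  let F₃ : TangentBundle ((𝓡 n).prod (𝓡 n)) (G × G) → TangentBundle (𝓡 n) G :=
    tangentMap ((𝓡 n).prod (𝓡 n)) (𝓡 n) (fun p : G × G => p.1 * p.2)
  have S₃ : ContMDiff ((𝓡 n).prod (𝓡 n)).tangent (𝓡 n).tangent ∞ F₃ :=
    (contMDiff_mul (𝓡 n) ∞).contMDiff_tangentMap (m := ∞) (by simp)
  have S := (S₃.comp S₂).comp S₁
  unfold SmoothField
  convert! S with g
  · simp [F₁, F₂, F₃, fg, fv]
  · simp only [Function.comp_apply, tangentMap, F₃, F₂, F₁, fg, fv]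
    rw [mfderiv_prod_eq_add_apply ((contMDiff_mul (𝓡 n) ∞).mdifferentiable (by simp) _)]
    refine Eq.trans ?_ (congrArg₂ (· + ·) (map_zero _) rfl).symm
    exact (zero_add _).symm

/-- A coframe of left-invariant `1`-forms has a dual frame of smooth vector fields. -/
lemma exists_smooth_dual_frame {θ : Fin n → OneForm n G}
    (hinv : ∀ (i : Fin n) (h x : G) (v : TangentSpace (𝓡 n) x),
      θ i (h * x) (mfderiv (𝓡 n) (𝓡 n) (fun y => h * y) x v) = θ i x v)
    (hind : LinearIndependent ℝ (fun i => θ i 1)) :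
    ∃ V : Fin n → VField n G, IsDualPair θ V ∧ ∀ j, SmoothField (V j) := by
  have hb := bijective_of_linearIndependent (finrank_tangentSpace (1 : G)) hind
  choose v hv using fun j : Fin n => hb.2 (Pi.single j 1)
  refine ⟨fun j => mulInvariantVectorField (v j), fun x i j => ?_,
    fun j => smoothField_mulInvariantVectorField (v j)⟩
  have h1 := hinv i x 1 (v j)
  have h2 := congrFun (hv j) i
  -- The form at `x * 1` and the form at `x` live on different tangent spaces; both are read on the
  -- model space to transport along `x * 1 = x`.
  have h3 : ∀ z : G, z = x → ∀ w : EuclideanSpace ℝ (Fin n), θ i z w = θ i x w := by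
    rintro z rfl w; rfl
  exact (h3 _ (mul_one x) _).symm.trans (h1.trans (h2.trans (by simp [Pi.single_apply])))

end LeftInvariant

/-! ### Pulling back structure equations along a smooth map. -/

section Pullback

variable {m n : ℕ} {N M : Type*} [TopologicalSpace N] [ChartedSpace (EuclideanSpace ℝ (Fin n)) N]
  [TopologicalSpace M] [ChartedSpace (EuclideanSpace ℝ (Fin m)) M]

/-- The pull-back of a `1`-form. -/
def pullbackForm (ι : M → N) (σ : OneForm n N) : OneForm m M :=
  fun x => (σ (ι x)).comp (mfderiv (𝓡 m) (𝓡 n) ι x)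

lemma dirDeriv_eq_sum {θ : Fin n → OneForm n N} {V : Fin n → VField n N} (h : IsDualPair θ V)
    (X : VField n N) (f : N → ℝ) (x : N) :
    dirDeriv X f x = ∑ j, θ j x (X x) * dirDeriv (V j) f x := by
  simp only [dirDeriv]
  conv_lhs => rw [h.eq_sum x (X x)]
  simp

/-- Chain rule along a map, in a frame of the target. -/
lemma dirDeriv_comp_eq_sum {θ : Fin n → OneForm n N} {V : Fin n → VField n N}
    (h : IsDualPair θ V) {ι : M → N} {f : N → ℝ} {x : M} (X : VField m M)
    (hι : MDifferentiableAt (𝓡 m) (𝓡 n) ι x)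
    (hf : MDifferentiableAt (𝓡 n) 𝓘(ℝ, ℝ) f (ι x)) :
    dirDeriv X (f ∘ ι) x = ∑ j, pullbackForm ι (θ j) x (X x) * dirDeriv (V j) f (ι x) := by
  simp only [dirDeriv]
  rw [mvfderiv_comp_apply x hf hι]
  conv_lhs => rw [h.eq_sum (ι x) (mfderiv (𝓡 m) (𝓡 n) ι x (X x))]
  simp [pullbackForm]

variable [IsManifold (𝓡 n) ∞ N] [IsManifold (𝓡 m) ∞ M]

lemma IsDualPair.contMDiffAt_pullbackForm {θ : Fin n → OneForm n N} {V : Fin n → VField n N}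
    (h : IsDualPair θ V) (hV : ∀ i, SmoothField (V i)) {ι : M → N}
    (hι : ContMDiff (𝓡 m) (𝓡 n) ∞ ι) (i : Fin n) {Y : VField m M} {x : M}
    (hY : SmoothFieldAt Y x) :
    ContMDiffAt (𝓡 m) 𝓘(ℝ, ℝ) ∞ (fun y => pullbackForm ι (θ i) y (Y y)) x := by
  have h1 := (hι.contMDiff_tangentMap (m := ∞) (by simp)).contMDiffAt.comp x hY
  exact h.contMDiffAt_coeff hV (b := ι) (w := fun y => mfderiv (𝓡 m) (𝓡 n) ι y (Y y)) h1 i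

/-- Functions whose differentials span the cotangent space at `x`. -/
lemma exists_contMDiffAt_coordinates (x : N) :
    ∃ u : Fin n → N → ℝ, (∀ a, ContMDiffAt (𝓡 n) 𝓘(ℝ, ℝ) ∞ (u a) x) ∧
      ∀ v : TangentSpace (𝓡 n) x, (∀ a, mvfderiv (𝓡 n) (u a) x v = 0) → v = 0 := by
  have hc : ContMDiffAt (𝓡 n) (𝓡 n) ∞ (extChartAt (𝓡 n) x) x := contMDiffAt_extChartAt
  have hp : ∀ a : Fin n, ContDiff ℝ ∞ (fun y : EuclideanSpace ℝ (Fin n) => y a) := fun a =>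
    contDiff_euclidean.mp contDiff_id a
  refine ⟨fun a => (fun y : EuclideanSpace ℝ (Fin n) => y a) ∘ extChartAt (𝓡 n) x,
    fun a => (hp a).contMDiff.contMDiffAt.comp x hc, ?_⟩
  intro v hv
  have hinv := isInvertible_mfderiv_extChartAt (I := 𝓡 n) (mem_extChartAt_source (I := 𝓡 n) x)
  refine hinv.injective ?_
  rw [map_zero]
  refine PiLp.ext fun a => ?_
  have h1 := hv a
  rw [mvfderiv_comp_apply x ((hp a).contMDiff.mdifferentiable (by simp) _)
    (hc.mdifferentiableAt (by simp))] at h1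
  have h2 : HasFDerivAt (fun y : EuclideanSpace ℝ (Fin n) => y a)
      (EuclideanSpace.proj a : EuclideanSpace ℝ (Fin n) →L[ℝ] ℝ) (extChartAt (𝓡 n) x x) :=
    (EuclideanSpace.proj a : EuclideanSpace ℝ (Fin n) →L[ℝ] ℝ).hasFDerivAt
  rw [mvfderiv, h2.hasMFDerivAt.mfderiv] at h1
  exact h1

/-- The index bookkeeping of `d1_pullbackForm`. There `s`, `t` are the components of `X`, `Y` along
the frame `V`, `P` and `Q` their derivatives, `L` the components of `[X,Y]`, and `g k = V_k u`, `H i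
j = V_i V_j u` for a test function `u`. Then `h1` is the commutator formula on the source, and `h2`
is the one on the target. -/
lemma antisymm_sum_identity {s t P Q L g : Fin n → ℝ} {D : Fin n → Fin n → Fin n → ℝ}
    {H : Fin n → Fin n → ℝ}
    (h1 : ∑ j, (t j * ∑ i, s i * H i j + P j * g j) - ∑ j, (s j * ∑ i, t i * H i j + Q j * g j)
      = ∑ k, L k * g k)
    (h2 : ∀ i j, H i j - H j i = - ∑ k, D k i j * g k) :
    ∑ k, (P k - Q k - L k - ∑ i, ∑ j, s i * t j * D k i j) * g k = 0 := by
  have h3 : ∑ k, (∑ i, ∑ j, s i * t j * D k i j) * g k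
      = - ∑ i, ∑ j, s i * t j * (H i j - H j i) := by
    simp only [h2, Finset.sum_mul, Finset.mul_sum, mul_neg, Finset.sum_neg_distrib, neg_neg]
    rw [Finset.sum_comm]
    refine Finset.sum_congr rfl fun i _ => ?_
    rw [Finset.sum_comm]
    exact Finset.sum_congr rfl fun j _ => Finset.sum_congr rfl fun k _ => by ring
  have h4 : ∑ j, t j * ∑ i, s i * H i j = ∑ i, ∑ j, s i * t j * H i j := by
    rw [Finset.sum_comm]
    exact Finset.sum_congr rfl fun j _ => by
      rw [Finset.mul_sum]; exact Finset.sum_congr rfl fun i _ => by ring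
  have h5 : ∑ j, s j * ∑ i, t i * H i j = ∑ i, ∑ j, s i * t j * H j i :=
    Finset.sum_congr rfl fun j _ => by
      rw [Finset.mul_sum]; exact Finset.sum_congr rfl fun i _ => by ring
  simp only [sub_mul, Finset.sum_sub_distrib, h3, mul_sub]
  simp only [Finset.sum_add_distrib, h4, h5] at h1
  linarith

/-- The structure equations of a smooth coframe pull back. -/
theorem d1_pullbackForm [NeZero n] [NeZero m] {θ : Fin n → OneForm n N} {V : Fin n → VField n N}
    (h : IsDualPair θ V) (hV : ∀ i, SmoothField (V i)) {ι : M → N}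
    (hι : ContMDiff (𝓡 m) (𝓡 n) ∞ ι) {X Y : VField m M} {x : M}
    (hX : SmoothFieldAt X x) (hY : SmoothFieldAt Y x) (k : Fin n) :
    d1 (pullbackForm ι (θ k)) X Y x = ∑ i, ∑ j, pullbackForm ι (θ i) x (X x) *
      pullbackForm ι (θ j) x (Y x) * d1 (θ k) (V i) (V j) (ι x) := by
  -- The fields `X`, `Y` need not push forward to vector fields on `N`, so the brackets on source
  -- and target are compared through their action on coordinate functions.
  obtain ⟨u, hu, hinj⟩ := exists_contMDiffAt_coordinates (n := n) (ι x)
  have hd1 : ∀ k i j z, d1 (θ k) (V i) (V j) z = - θ k z (lieBr (V i) (V j) z) := by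
    intro k i j z
    simp only [d1, h _ k, dirDeriv_const]
    ring
  have hpull : ∀ i {Z : VField m M}, SmoothFieldAt Z x →
      MDifferentiableAt (𝓡 m) 𝓘(ℝ, ℝ) (fun y => pullbackForm ι (θ i) y (Z y)) x := fun i Z hZ =>
    (h.contMDiffAt_pullbackForm hV hι i hZ).mdifferentiableAt (by simp)
  have hιd : MDifferentiable (𝓡 m) (𝓡 n) ι := hι.mdifferentiable (by simp)
  -- The chain rule, applied twice, for second derivatives of `u a ∘ ι`.
  have hsecond : ∀ a {Z W : VField m M}, SmoothFieldAt Z x → SmoothFieldAt W x →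
      dirDeriv Z (dirDeriv W (u a ∘ ι)) x = ∑ j, (pullbackForm ι (θ j) x (W x) *
        ∑ i, pullbackForm ι (θ i) x (Z x) * dirDeriv (V i) (dirDeriv (V j) (u a)) (ι x)
        + dirDeriv Z (fun y => pullbackForm ι (θ j) y (W y)) x * dirDeriv (V j) (u a) (ι x)) := by
    intro a Z W hZ hW
    have hev : dirDeriv W (u a ∘ ι) =ᶠ[nhds x] fun y => ∑ j, pullbackForm ι (θ j) y (W y) *
        (dirDeriv (V j) (u a) ∘ ι) y := by
      have h1 := (contMDiffAt_iff_contMDiffAt_nhds (by simp)).mp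
        ((hu a).of_le (show (1 : ℕ∞ω) ≤ ∞ by simp))
      filter_upwards [(hι.continuous.tendsto x).eventually h1] with y hy
      exact dirDeriv_comp_eq_sum h W (hιd y) (hy.mdifferentiableAt (by simp))
    have hg : ∀ j, MDifferentiableAt (𝓡 n) 𝓘(ℝ, ℝ) (dirDeriv (V j) (u a)) (ι x) := fun j =>
      ((hu a).dirDeriv (hV j (ι x))).mdifferentiableAt (by simp)
    have hgι : ∀ j, MDifferentiableAt (𝓡 m) 𝓘(ℝ, ℝ) (dirDeriv (V j) (u a) ∘ ι) x := fun j =>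
      (hg j).comp x (hιd x)
    rw [hev.dirDeriv_eq, dirDeriv_sum (f := fun j y => pullbackForm ι (θ j) y (W y) *
      (dirDeriv (V j) (u a) ∘ ι) y) _ _ fun j _ => (hpull j hW).mul (hgι j)]
    refine Finset.sum_congr rfl fun j _ => ?_
    rw [dirDeriv_mul Z (hpull j hW) (hgι j), dirDeriv_comp_eq_sum h Z (hιd x) (hg j)]
    rfl
  have key : ∀ a, ∑ k, (d1 (pullbackForm ι (θ k)) X Y x - ∑ i, ∑ j, pullbackForm ι (θ i) x (X x) *
      pullbackForm ι (θ j) x (Y x) * d1 (θ k) (V i) (V j) (ι x)) *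
        dirDeriv (V k) (u a) (ι x) = 0 := by
    intro a
    refine antisymm_sum_identity
      (H := fun i j => dirDeriv (V i) (dirDeriv (V j) (u a)) (ι x)) ?_ fun i j => ?_
    · rw [← hsecond a hX hY, ← hsecond a hY hX,
        ← dirDeriv_lieBr hX hY ((hu a).comp x (hι x)),
        dirDeriv_comp_eq_sum h _ (hιd x) ((hu a).mdifferentiableAt (by simp))]
    · rw [← dirDeriv_lieBr (hV i (ι x)) (hV j (ι x)) (hu a), dirDeriv_eq_sum h]
      simp [hd1]
  set c : Fin n → ℝ := fun k => d1 (pullbackForm ι (θ k)) X Y x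
    - ∑ i, ∑ j, pullbackForm ι (θ i) x (X x) *
      pullbackForm ι (θ j) x (Y x) * d1 (θ k) (V i) (V j) (ι x) with hc
  -- All the differentials `du_a` annihilate this vector, so it vanishes; `θ k` then extracts its
  -- coefficient.
  have hv : ∑ k, c k • V k (ι x) = 0 := hinj _ fun a => by
    simpa [dirDeriv] using key a
  have := congrArg (θ k (ι x)) hv
  simp only [map_sum, map_smul, h (ι x) k, smul_eq_mul, mul_ite, mul_one, mul_zero,
    Finset.sum_ite_eq, Finset.mem_univ, if_true, map_zero] at this
  exact sub_eq_zero.mp this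

end Pullback

/-! ### The restricted structure equations on `M`. -/

section AdaptedFrame

variable {M : Type*} [TopologicalSpace M] [ChartedSpace (EuclideanSpace ℝ (Fin 5)) M]

lemma dualFrame_isDualPair {e : Fin 5 → OneForm 5 M}
    (hind : ∀ x, LinearIndependent ℝ (fun i => e i x)) : IsDualPair e (dualFrame e) := by
  intro x i j
  have hb := bijective_of_linearIndependent (finrank_tangentSpace x) (hind x)
  have h : (fun k => e k x (dualFrame e j x)) = Pi.single j 1 :=
    Function.invFun_eq (hb.2 (Pi.single j 1))
  rw [congrFun h i, Pi.single_apply]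

variable [IsManifold (𝓡 5) ∞ M]

/-- A smooth coframe `e` with dual frame `E` that satisfies, together with the `1`-form `A`, the
structure equations of the family. -/
structure IsAdaptedFrame (a₁ a₂ a₃ a₄ : ℝ) (e : Fin 5 → OneForm 5 M) (A : OneForm 5 M)
    (E : Fin 5 → VField 5 M) : Prop where
  dual : IsDualPair e E
  smooth_frame : ∀ i, SmoothField (E i)
  smooth_coframe : ∀ i X, SmoothField X → SmoothFun 5 (fun y => e i y (X y))
  smooth_coframe_at : ∀ i x (X : VField 5 M), SmoothFieldAt X x →
    ContMDiffAt (𝓡 5) 𝓘(ℝ, ℝ) ∞ (fun y => e i y (X y)) x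
  smooth_conn : ∀ X, SmoothField X → SmoothFun 5 (fun y => A y (X y))
  d_zero : ∀ X Y, SmoothField X → SmoothField Y → ∀ x, d1 (e 0) X Y x =
    wedge A (e 1) x (X x) (Y x) - (2 * a₁ + a₃) * wedge (e 2) (e 4) x (X x) (Y x)
      - (2 * a₂ + a₄) * wedge (e 3) (e 4) x (X x) (Y x)
  d_one : ∀ X Y, SmoothField X → SmoothField Y → ∀ x, d1 (e 1) X Y x =
    -wedge A (e 0) x (X x) (Y x) + (2 * a₁ + a₃) * wedge (e 3) (e 4) x (X x) (Y x)
      - (2 * a₂ + a₄) * wedge (e 2) (e 4) x (X x) (Y x)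
  d_two : ∀ X Y, SmoothField X → SmoothField Y → ∀ x, d1 (e 2) X Y x =
    -wedge A (e 3) x (X x) (Y x) + (2 * a₁ + a₃) * wedge (e 0) (e 4) x (X x) (Y x)
      + (2 * a₂ + a₄) * wedge (e 1) (e 4) x (X x) (Y x)
  d_three : ∀ X Y, SmoothField X → SmoothField Y → ∀ x, d1 (e 3) X Y x =
    wedge A (e 2) x (X x) (Y x) - (2 * a₁ + a₃) * wedge (e 1) (e 4) x (X x) (Y x)
      + (2 * a₂ + a₄) * wedge (e 0) (e 4) x (X x) (Y x)
  d_four : ∀ X Y, SmoothField X → SmoothField Y → ∀ x, d1 (e 4) X Y x =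
    -2 * (a₁ - a₃) * (wedge (e 0) (e 2) x (X x) (Y x) - wedge (e 1) (e 3) x (X x) (Y x))
      - 2 * (a₂ - a₄) * (wedge (e 0) (e 3) x (X x) (Y x) + wedge (e 1) (e 2) x (X x) (Y x))
  d_conn : ∀ X Y, SmoothField X → SmoothField Y → ∀ x, d1 A X Y x =
    alphaConst a₁ a₂ a₃ a₄ *
      (wedge (e 0) (e 1) x (X x) (Y x) - wedge (e 2) (e 3) x (X x) (Y x))

/-- The only place where the group structure matters: it supplies the smooth frame dual to `θ` along
which the equations are pulled back. On `M` the form `A_2` is no longer independent of `e_1, …, e_5`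
but serves as the connection form. -/
theorem isAdaptedFrame_restrictedCoframe {a₁ a₂ a₃ a₄ : ℝ}
    {G : Type*} [TopologicalSpace G] [ChartedSpace (EuclideanSpace ℝ (Fin 6)) G] [Group G]
    [LieGroup (𝓡 6) ∞ G] {θ : Fin 6 → OneForm 6 G} (hθ : IsStructureCoframe a₁ a₂ a₃ a₄ θ)
    {ι : M → G} (hι : ContMDiff (𝓡 5) (𝓡 6) ∞ ι)
    (hind : ∀ x, LinearIndependent ℝ (fun i => restrictedCoframe θ ι i x)) :
    IsAdaptedFrame a₁ a₂ a₃ a₄ (restrictedCoframe θ ι) (pullbackForm ι (θ 5))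
      (dualFrame (restrictedCoframe θ ι)) := by
  obtain ⟨V, hdual, hV⟩ := exists_smooth_dual_frame hθ.leftInvariant (hθ.independent 1)
  have : IsManifold (𝓡 6) ∞ G := inferInstance
  have hsm : ∀ (i : Fin 6) (x : M) (Y : VField 5 M), SmoothFieldAt Y x →
      ContMDiffAt (𝓡 5) 𝓘(ℝ, ℝ) ∞ (fun y => pullbackForm ι (θ i) y (Y y)) x := fun i x Y hY =>
    hdual.contMDiffAt_pullbackForm hV hι i hY
  have hd := dualFrame_isDualPair hind
  have hs : ∀ (k : Fin 6) (X Y : VField 5 M), SmoothField X → SmoothField Y → ∀ x,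
      d1 (pullbackForm ι (θ k)) X Y x = structureForms a₁ a₂ a₃ a₄ θ k (ι x)
        (mfderiv (𝓡 5) (𝓡 6) ι x (X x)) (mfderiv (𝓡 5) (𝓡 6) ι x (Y x)) := by
    intro k X Y hX hY x
    rw [d1_pullbackForm hdual hV hι (hX x) (hY x) k]
    simp only [hθ.structure_eq k _ _ (hV _) (hV _)]
    fin_cases k <;>
    · simp [Fin.sum_univ_succ, structureForms, wedge, hdual (ι x), pullbackForm]
      try ring
  exact
  { dual := hd
    smooth_frame := hd.smoothField fun i x Y hY => hsm i.castSucc x Y hY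
    smooth_coframe := fun i X hX x => hsm i.castSucc x X (hX x)
    smooth_coframe_at := fun i x X hX => hsm i.castSucc x X hX
    smooth_conn := fun X hX x => hsm 5 x X (hX x)
    d_zero := fun X Y hX hY x => hs 0 X Y hX hY x
    d_one := fun X Y hX hY x => hs 1 X Y hX hY x
    d_two := fun X Y hX hY x => hs 2 X Y hX hY x
    d_three := fun X Y hX hY x => hs 3 X Y hX hY x
    d_four := fun X Y hX hY x => hs 4 X Y hX hY x
    d_conn := fun X Y hX hY x => hs 5 X Y hX hY x }

end AdaptedFrame

/-! ### The adapted almost contact metric structure and its Nijenhuis tensor. -/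

section AdaptedStructure

variable {M : Type*} [TopologicalSpace M] [ChartedSpace (EuclideanSpace ℝ (Fin 5)) M]

/-- Turns the structure equations into formulas for brackets; the tensors below that involve
brackets are computed through it. -/
lemma coframe_lieBr (σ : OneForm 5 M) (X Y : VField 5 M) (x : M) :
    σ x (lieBr X Y x) = dirDeriv X (fun y => σ y (Y y)) x - dirDeriv Y (fun y => σ y (X y)) x
      - d1 σ X Y x := by
  simp only [d1]; ring

lemma adaptedACM_g (e : Fin 5 → OneForm 5 M) (x : M) (v w : TangentSpace (𝓡 5) x) :
    (adaptedACM e).g x v w = ∑ k, e k x v * e k x w := by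
  simp [adaptedACM]

lemma adaptedACM_ip (e : Fin 5 → OneForm 5 M) (X Y : VField 5 M) (x : M) :
    (adaptedACM e).ip X Y x = ∑ k, e k x (X x) * e k x (Y x) := adaptedACM_g e x _ _

section Phi

variable {e : Fin 5 → OneForm 5 M} (h : IsDualPair e (dualFrame e)) (x : M)
  (v : TangentSpace (𝓡 5) x)
include h

lemma coframe_φ_zero : e 0 x ((adaptedACM e).φ x v) = e 1 x v := by
  simp [adaptedACM, h x]

lemma coframe_φ_one : e 1 x ((adaptedACM e).φ x v) = - e 0 x v := by
  simp [adaptedACM, h x]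

lemma coframe_φ_two : e 2 x ((adaptedACM e).φ x v) = e 3 x v := by
  simp [adaptedACM, h x]

lemma coframe_φ_three : e 3 x ((adaptedACM e).φ x v) = - e 2 x v := by
  simp [adaptedACM, h x]

lemma coframe_φ_four : e 4 x ((adaptedACM e).φ x v) = 0 := by
  simp [adaptedACM, h x]

end Phi

lemma adaptedACM_fundForm {e : Fin 5 → OneForm 5 M} (h : IsDualPair e (dualFrame e)) :
    (adaptedACM e).fundForm = wedge (e 0) (e 1) + wedge (e 2) (e 3) := by
  ext x v w
  simp only [ACMData.fundForm, adaptedACM_g, Fin.sum_univ_five, coframe_φ_zero h, coframe_φ_one h,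
    coframe_φ_two h, coframe_φ_three h, coframe_φ_four h, wedge, Pi.add_apply]
  ring

lemma SmoothFun.mul {f g : M → ℝ} (hf : SmoothFun 5 f) (hg : SmoothFun 5 g) :
    SmoothFun 5 (fun y => f y * g y) := ContMDiff.mul hf hg

lemma SmoothFun.sub {f g : M → ℝ} (hf : SmoothFun 5 f) (hg : SmoothFun 5 g) :
    SmoothFun 5 (fun y => f y - g y) := ContMDiff.sub hf hg

lemma SmoothFun.add {f g : M → ℝ} (hf : SmoothFun 5 f) (hg : SmoothFun 5 g) :
    SmoothFun 5 (fun y => f y + g y) := ContMDiff.add hf hg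

lemma SmoothFun.neg {f : M → ℝ} (hf : SmoothFun 5 f) : SmoothFun 5 (fun y => - f y) :=
  ContMDiff.neg hf

lemma smoothFun_const (c : ℝ) : SmoothFun 5 (fun _ : M => c) := contMDiff_const

/-- `d(σ ∧ τ) = dσ ∧ τ - σ ∧ dτ`. -/
lemma d2_wedge {σ τ : OneForm 5 M} {X Y Z : VField 5 M} {x : M}
    (hσX : SmoothFun 5 fun y => σ y (X y)) (hσY : SmoothFun 5 fun y => σ y (Y y))
    (hσZ : SmoothFun 5 fun y => σ y (Z y)) (hτX : SmoothFun 5 fun y => τ y (X y))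
    (hτY : SmoothFun 5 fun y => τ y (Y y)) (hτZ : SmoothFun 5 fun y => τ y (Z y)) :
    d2 (wedge σ τ) X Y Z x =
      d1 σ X Y x * τ x (Z x) - d1 σ X Z x * τ x (Y x) + d1 σ Y Z x * τ x (X x)
      - (σ x (X x) * d1 τ Y Z x - σ x (Y x) * d1 τ X Z x + σ x (Z x) * d1 τ X Y x) := by
  have hw : ∀ {U W : VField 5 M} (T : VField 5 M), SmoothFun 5 (fun y => σ y (U y)) →
      SmoothFun 5 (fun y => σ y (W y)) → SmoothFun 5 (fun y => τ y (U y)) →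
      SmoothFun 5 (fun y => τ y (W y)) →
      dirDeriv T (fun y => wedge σ τ y (U y) (W y)) x =
        σ x (U x) * dirDeriv T (fun y => τ y (W y)) x + dirDeriv T (fun y => σ y (U y)) x * τ x (W x)
        - (σ x (W x) * dirDeriv T (fun y => τ y (U y)) x
          + dirDeriv T (fun y => σ y (W y)) x * τ x (U x)) := by
    intro U W T h1 h2 h3 h4
    simp only [wedge]
    rw [dirDeriv_sub T ((h1.mul h4).mdifferentiableAt x) ((h2.mul h3).mdifferentiableAt x),
      dirDeriv_mul T (h1.mdifferentiableAt x) (h4.mdifferentiableAt x),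
      dirDeriv_mul T (h2.mdifferentiableAt x) (h3.mdifferentiableAt x)]
  simp only [d2, hw X hσY hσZ hτY hτZ, hw Y hσX hσZ hτX hτZ, hw Z hσX hσY hτX hτY]
  simp only [wedge, d1]
  ring

lemma d2_add {β β' : TwoForm 5 M} {X Y Z : VField 5 M} (x : M)
    (h1 : SmoothFun 5 fun y => β y (Y y) (Z y)) (h2 : SmoothFun 5 fun y => β y (X y) (Z y))
    (h3 : SmoothFun 5 fun y => β y (X y) (Y y)) (h1' : SmoothFun 5 fun y => β' y (Y y) (Z y))
    (h2' : SmoothFun 5 fun y => β' y (X y) (Z y)) (h3' : SmoothFun 5 fun y => β' y (X y) (Y y)) :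
    d2 (β + β') X Y Z x = d2 β X Y Z x + d2 β' X Y Z x := by
  simp only [d2, Pi.add_apply]
  rw [dirDeriv_add X (h1.mdifferentiableAt x) (h1'.mdifferentiableAt x),
    dirDeriv_add Y (h2.mdifferentiableAt x) (h2'.mdifferentiableAt x),
    dirDeriv_add Z (h3.mdifferentiableAt x) (h3'.mdifferentiableAt x)]
  ring

lemma d2_sub {β β' : TwoForm 5 M} {X Y Z : VField 5 M} (x : M)
    (h1 : SmoothFun 5 fun y => β y (Y y) (Z y)) (h2 : SmoothFun 5 fun y => β y (X y) (Z y))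
    (h3 : SmoothFun 5 fun y => β y (X y) (Y y)) (h1' : SmoothFun 5 fun y => β' y (Y y) (Z y))
    (h2' : SmoothFun 5 fun y => β' y (X y) (Z y)) (h3' : SmoothFun 5 fun y => β' y (X y) (Y y)) :
    d2 (β - β') X Y Z x = d2 β X Y Z x - d2 β' X Y Z x := by
  simp only [d2, Pi.sub_apply]
  rw [dirDeriv_sub X (h1.mdifferentiableAt x) (h1'.mdifferentiableAt x),
    dirDeriv_sub Y (h2.mdifferentiableAt x) (h2'.mdifferentiableAt x),
    dirDeriv_sub Z (h3.mdifferentiableAt x) (h3'.mdifferentiableAt x)]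
  ring

variable [IsManifold (𝓡 5) ∞ M]

namespace IsAdaptedFrame

variable {a₁ a₂ a₃ a₄ : ℝ} {e : Fin 5 → OneForm 5 M} {A : OneForm 5 M} {E : Fin 5 → VField 5 M}

section General
variable (h : IsAdaptedFrame a₁ a₂ a₃ a₄ e A E)
include h

lemma smoothField_of_coframe {X : VField 5 M}
    (hX : ∀ k, SmoothFun 5 (fun y => e k y (X y))) : SmoothField X := by
  have h1 : SmoothField (fun y => ∑ k, e k y (X y) • E k y) := fun x =>
    ContMDiffAt.sum_section fun k _ => (hX k x).smul_section (h.smooth_frame k x)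
  have h2 : X = fun y => ∑ k, e k y (X y) • E k y := funext fun y => h.dual.eq_sum y (X y)
  rw [h2]; exact h1

/-- Constant coefficients in the frame extend a tangent vector, so identities known for smooth
fields apply to single vectors. -/
lemma smoothField_const (x : M) (v : TangentSpace (𝓡 5) x) :
    ∃ X : VField 5 M, SmoothField X ∧ X x = v := by
  refine ⟨fun y => ∑ k, e k x v • E k y, fun y => ContMDiffAt.sum_section fun k _ =>
    contMDiffAt_const.smul_section (h.smooth_frame k y), (h.dual.eq_sum x v).symm⟩

lemma smoothFun_wedge {X Y : VField 5 M} (hX : SmoothField X) (hY : SmoothField Y) (i j : Fin 5) :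
    SmoothFun 5 (fun y => wedge (e i) (e j) y (X y) (Y y)) :=
  ((h.smooth_coframe i X hX).mul (h.smooth_coframe j Y hY)).sub
    ((h.smooth_coframe i Y hY).mul (h.smooth_coframe j X hX))

lemma d2_wedge {X Y Z : VField 5 M} (hX : SmoothField X) (hY : SmoothField Y)
    (hZ : SmoothField Z) (i j : Fin 5) (x : M) :
    d2 (wedge (e i) (e j)) X Y Z x =
      d1 (e i) X Y x * e j x (Z x) - d1 (e i) X Z x * e j x (Y x) + d1 (e i) Y Z x * e j x (X x)
      - (e i x (X x) * d1 (e j) Y Z x - e i x (Y x) * d1 (e j) X Z x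
        + e i x (Z x) * d1 (e j) X Y x) :=
  _root_.d2_wedge (h.smooth_coframe i X hX) (h.smooth_coframe i Y hY) (h.smooth_coframe i Z hZ)
    (h.smooth_coframe j X hX) (h.smooth_coframe j Y hY) (h.smooth_coframe j Z hZ)

/-- The form `F` is closed. -/
theorem d2_formF {X Y Z : VField 5 M} (hX : SmoothField X) (hY : SmoothField Y)
    (hZ : SmoothField Z) (x : M) : d2 (formF e) X Y Z x = 0 := by
  rw [formF, d2_sub x (h.smoothFun_wedge hY hZ 0 1) (h.smoothFun_wedge hX hZ 0 1)
    (h.smoothFun_wedge hX hY 0 1) (h.smoothFun_wedge hY hZ 2 3) (h.smoothFun_wedge hX hZ 2 3)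
    (h.smoothFun_wedge hX hY 2 3), h.d2_wedge hX hY hZ, h.d2_wedge hX hY hZ]
  -- The `A_2` terms drop out of `d(e_1 ∧ e_2)` and of `d(e_3 ∧ e_4)`, and what is left of these two
  -- 3-forms coincides.
  simp only [h.d_zero _ _ hX hY, h.d_zero _ _ hX hZ, h.d_zero _ _ hY hZ, h.d_one _ _ hX hY,
    h.d_one _ _ hX hZ, h.d_one _ _ hY hZ, h.d_two _ _ hX hY, h.d_two _ _ hX hZ, h.d_two _ _ hY hZ,
    h.d_three _ _ hX hY, h.d_three _ _ hX hZ, h.d_three _ _ hY hZ, wedge]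
  ring

end General

section Structure
variable (h : IsAdaptedFrame a₁ a₂ a₃ a₄ e A (dualFrame e))
include h

lemma smoothField_ap {X : VField 5 M} (hX : SmoothField X) : SmoothField ((adaptedACM e).ap X) := by
  refine h.smoothField_of_coframe fun k => ?_
  fin_cases k
  · simpa [ACMData.ap, coframe_φ_zero h.dual] using h.smooth_coframe 1 X hX
  · simpa [ACMData.ap, coframe_φ_one h.dual] using (h.smooth_coframe 0 X hX).neg
  · simpa [ACMData.ap, coframe_φ_two h.dual] using h.smooth_coframe 3 X hX
  · simpa [ACMData.ap, coframe_φ_three h.dual] using (h.smooth_coframe 2 X hX).neg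
  · simpa [ACMData.ap, coframe_φ_four h.dual] using smoothFun_const 0

lemma isAlmostContactMetric : (adaptedACM e).IsAlmostContactMetric where
  g_symm x v w := by simp only [adaptedACM_g, mul_comm]
  g_pos x v hv := by
    rw [adaptedACM_g]
    refine lt_of_le_of_ne (Finset.sum_nonneg fun k _ => mul_self_nonneg _) fun h0 => hv ?_
    refine h.dual.vec_ext fun k => ?_
    have := (Finset.sum_eq_zero_iff_of_nonneg fun k _ => mul_self_nonneg (e k x v)).mp h0.symm k
      (Finset.mem_univ _)
    simpa using this
  g_smooth X Y hX hY := by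
    have h1 : (adaptedACM e).ip X Y = fun x => ∑ k, e k x (X x) * e k x (Y x) :=
      funext fun x => adaptedACM_ip e X Y x
    rw [h1]
    exact fun x => ContMDiffAt.sum fun k _ => (h.smooth_coframe k X hX x).mul (h.smooth_coframe k Y hY x)
  ξ_smooth := h.smooth_frame 4
  ξ_unit x := by
    rw [adaptedACM_g]
    simp [adaptedACM, h.dual x]
  η_dual x v := by
    rw [adaptedACM_g]
    simp [adaptedACM, h.dual x]
  φ_smooth X hX := h.smoothField_ap hX
  φ_ξ x := by
    simp [adaptedACM, h.dual x]
  φ_sq x v := by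
    refine h.dual.vec_ext fun k => ?_
    have hη : (adaptedACM e).η = e 4 := rfl
    have hξ : (adaptedACM e).ξ = dualFrame e 4 := rfl
    fin_cases k <;> simp [coframe_φ_zero h.dual, coframe_φ_one h.dual, coframe_φ_two h.dual,
      coframe_φ_three h.dual, coframe_φ_four h.dual, hη, hξ, h.dual x]
  g_φ x v w := by
    have hη : (adaptedACM e).η = e 4 := rfl
    simp only [adaptedACM_g, Fin.sum_univ_five, coframe_φ_zero h.dual, coframe_φ_one h.dual,
      coframe_φ_two h.dual, coframe_φ_three h.dual, coframe_φ_four h.dual, hη]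
    ring

/-- The Nijenhuis tensor in coordinates. -/
theorem nijenhuis_eq {X Y Z : VField 5 M} (hY : SmoothField Y) (hZ : SmoothField Z) (x : M) :
    (adaptedACM e).nijenhuis X Y Z x =
      -2 * (2 * a₁ + a₃) * (e 0 x (X x) * wedge (e 2) (e 4) x (Y x) (Z x)
        - e 1 x (X x) * wedge (e 3) (e 4) x (Y x) (Z x)
        - e 2 x (X x) * wedge (e 0) (e 4) x (Y x) (Z x)
        + e 3 x (X x) * wedge (e 1) (e 4) x (Y x) (Z x))
      - 2 * (2 * a₂ + a₄) * (e 0 x (X x) * wedge (e 3) (e 4) x (Y x) (Z x)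
        + e 1 x (X x) * wedge (e 2) (e 4) x (Y x) (Z x)
        - e 2 x (X x) * wedge (e 1) (e 4) x (Y x) (Z x)
        - e 3 x (X x) * wedge (e 0) (e 4) x (Y x) (Z x))
      + 2 * e 4 x (X x) *
        (-2 * (a₁ - a₃) * (wedge (e 0) (e 2) x (Y x) (Z x) - wedge (e 1) (e 3) x (Y x) (Z x))
      - 2 * (a₂ - a₄) * (wedge (e 0) (e 3) x (Y x) (Z x) + wedge (e 1) (e 2) x (Y x) (Z x))) := by
  have hη : (adaptedACM e).η = e 4 := rfl
  have hφY := h.smoothField_ap hY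
  have hφZ := h.smoothField_ap hZ
  have hap : ∀ (W : VField 5 M) (y : M), (adaptedACM e).ap W y = (adaptedACM e).φ y (W y) :=
    fun _ _ => rfl
  rw [ACMData.nijenhuis, adaptedACM_ip]
  -- Since `φ` only permutes components up to sign, the derivatives of components of `Y` and `Z`
  -- cancel. The `A_2` terms cancel as well, being rotations that commute with `φ`.
  simp only [ACMData.nijenhuisTorsion, Pi.sub_apply, Pi.add_apply, map_sub, map_add, hap,
    Fin.sum_univ_five, coframe_φ_zero h.dual, coframe_φ_one h.dual, coframe_φ_two h.dual,
    coframe_φ_three h.dual, coframe_φ_four h.dual, coframe_lieBr, hη, dirDeriv_neg, dirDeriv_const,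
    h.d_zero _ _ hφY hφZ, h.d_one _ _ hφY hφZ, h.d_two _ _ hφY hφZ, h.d_three _ _ hφY hφZ,
    h.d_four _ _ hφY hφZ, h.d_zero _ _ hφY hZ, h.d_one _ _ hφY hZ, h.d_two _ _ hφY hZ,
    h.d_three _ _ hφY hZ, h.d_zero _ _ hY hφZ, h.d_one _ _ hY hφZ,
    h.d_two _ _ hY hφZ, h.d_three _ _ hY hφZ, h.d_zero _ _ hY hZ,
    h.d_one _ _ hY hZ, h.d_two _ _ hY hZ, h.d_three _ _ hY hZ, h.d_four _ _ hY hZ, wedge]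
  ring

end Structure

end IsAdaptedFrame

end AdaptedStructure

/-! ### Generalized quasi-Sasaki property and the type of `N`. -/

section AdaptedGeometry

variable {M : Type*} [TopologicalSpace M] [ChartedSpace (EuclideanSpace ℝ (Fin 5)) M]

/-- For a square matrix, orthonormal rows force orthonormal columns. -/
lemma orthonormal_sum {e : Fin 5 → OneForm 5 M} {F : Fin 5 → VField 5 M} {x : M}
    (hF : (adaptedACM e).OrthonormalAt F x) (k l : Fin 5) : ∑ i, e k x (F i x) * e l x (F i x) = if k = l then 1 else 0 := by
  let O : Matrix (Fin 5) (Fin 5) ℝ := Matrix.of fun i k => e k x (F i x)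
  have h1 : O * O.transpose = 1 := by
    ext i j
    rw [Matrix.mul_apply, Matrix.one_apply, ← hF i j, adaptedACM_g]
    rfl
  have h2 : (O.transpose * O) k l = (1 : Matrix (Fin 5) (Fin 5) ℝ) k l := by
    rw [mul_eq_one_comm.mp h1]
  rw [Matrix.mul_apply, Matrix.one_apply] at h2
  exact h2

variable [IsManifold (𝓡 5) ∞ M]

namespace IsAdaptedFrame

variable {a₁ a₂ a₃ a₄ : ℝ} {e : Fin 5 → OneForm 5 M} {A : OneForm 5 M}
  (h : IsAdaptedFrame a₁ a₂ a₃ a₄ e A (dualFrame e))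
include h

lemma ip_ξ (X : VField 5 M) (x : M) : (adaptedACM e).ip X (adaptedACM e).ξ x = e 4 x (X x) := by
  have hξ : (adaptedACM e).ξ = dualFrame e 4 := rfl
  simp [adaptedACM_ip, hξ, h.dual x]

lemma dirDeriv_ip (T : VField 5 M) {X Y : VField 5 M} (hX : SmoothField X) (hY : SmoothField Y)
    (x : M) : dirDeriv T ((adaptedACM e).ip X Y) x =
      ∑ k, (e k x (X x) * dirDeriv T (fun y => e k y (Y y)) x
        + dirDeriv T (fun y => e k y (X y)) x * e k x (Y x)) := by
  have h1 : (adaptedACM e).ip X Y = fun x => ∑ k, e k x (X x) * e k x (Y x) :=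
    funext fun x => adaptedACM_ip e X Y x
  have hs := fun k => (h.smooth_coframe k X hX).mdifferentiableAt x
  have ht := fun k => (h.smooth_coframe k Y hY).mdifferentiableAt x
  rw [h1, dirDeriv_sum (f := fun k x => e k x (X x) * e k x (Y x)) _ _ fun k _ =>
    ((h.smooth_coframe k X hX).mul (h.smooth_coframe k Y hY)).mdifferentiableAt x]
  exact Finset.sum_congr rfl fun k _ => dirDeriv_mul T (hs k) (ht k)

/-- In the Lie derivative of `g` the derivatives of components cancel, leaving the symmetrized
contractions of `de_k` with `ξ`. These form a skew matrix: `A_2` and `e_5` enter `de_1, …, de_4`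
through infinitesimal rotations, and `de_5` has no `e_5` factor. -/
theorem isKillingField : (adaptedACM e).IsKillingField := by
  intro X Y hX hY x
  have hξ : (adaptedACM e).ξ = dualFrame e 4 := rfl
  have hs := h.smooth_frame 4
  rw [h.dirDeriv_ip _ hX hY, adaptedACM_ip, adaptedACM_ip, hξ]
  simp only [Fin.sum_univ_five, coframe_lieBr, h.d_zero _ _ hs hX, h.d_one _ _ hs hX,
    h.d_two _ _ hs hX, h.d_three _ _ hs hX, h.d_four _ _ hs hX, h.d_zero _ _ hs hY,
    h.d_one _ _ hs hY, h.d_two _ _ hs hY, h.d_three _ _ hs hY, h.d_four _ _ hs hY, wedge,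
    h.dual _ _ 4, dirDeriv_const]
  simp
  ring

lemma d2_fundForm {X Y Z : VField 5 M} (hX : SmoothField X) (hY : SmoothField Y)
    (hZ : SmoothField Z) (x : M) : d2 (adaptedACM e).fundForm X Y Z x =
      d1 (e 0) X Y x * e 1 x (Z x) - d1 (e 0) X Z x * e 1 x (Y x) + d1 (e 0) Y Z x * e 1 x (X x)
      - (e 0 x (X x) * d1 (e 1) Y Z x - e 0 x (Y x) * d1 (e 1) X Z x
        + e 0 x (Z x) * d1 (e 1) X Y x)
      + (d1 (e 2) X Y x * e 3 x (Z x) - d1 (e 2) X Z x * e 3 x (Y x) + d1 (e 2) Y Z x * e 3 x (X x)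
      - (e 2 x (X x) * d1 (e 3) Y Z x - e 2 x (Y x) * d1 (e 3) X Z x
        + e 2 x (Z x) * d1 (e 3) X Y x)) := by
  rw [adaptedACM_fundForm h.dual, d2_add x (h.smoothFun_wedge hY hZ 0 1)
    (h.smoothFun_wedge hX hZ 0 1) (h.smoothFun_wedge hX hY 0 1) (h.smoothFun_wedge hY hZ 2 3)
    (h.smoothFun_wedge hX hZ 2 3) (h.smoothFun_wedge hX hY 2 3), h.d2_wedge hX hY hZ,
    h.d2_wedge hX hY hZ]

theorem isGeneralizedQuasiSasaki : (adaptedACM e).IsGeneralizedQuasiSasaki where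
  almostContactMetric := h.isAlmostContactMetric
  nijenhuis_eq_zero X Y Z hX hY hZ x hX4 hY4 hZ4 := by
    rw [h.ip_ξ] at hX4 hY4 hZ4
    rw [h.nijenhuis_eq hY hZ]
    simp only [wedge, hX4, hY4, hZ4]
    ring
  dΦ_eq_zero X Y Z hX hY hZ x hX4 hY4 hZ4 := by
    rw [h.ip_ξ] at hX4 hY4 hZ4
    rw [h.d2_fundForm hX hY hZ]
    simp only [h.d_zero _ _ hX hY, h.d_zero _ _ hX hZ, h.d_zero _ _ hY hZ, h.d_one _ _ hX hY,
      h.d_one _ _ hX hZ, h.d_one _ _ hY hZ, h.d_two _ _ hX hY, h.d_two _ _ hX hZ,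
      h.d_two _ _ hY hZ, h.d_three _ _ hX hY, h.d_three _ _ hX hZ, h.d_three _ _ hY hZ, wedge,
      hX4, hY4, hZ4]
    ring
  killing := h.isKillingField

theorem nijenhuis_ξ {X Y : VField 5 M} (hX : SmoothField X) (hY : SmoothField Y) (x : M) :
    (adaptedACM e).nijenhuis (adaptedACM e).ξ X Y x = 2 * d1 (adaptedACM e).η X Y x := by
  have hξ : (adaptedACM e).ξ = dualFrame e 4 := rfl
  have hη : (adaptedACM e).η = e 4 := rfl
  rw [h.nijenhuis_eq hX hY, hξ, hη, h.d_four _ _ hX hY]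
  simp [h.dual x]

theorem isTotallySkew_iff [Nonempty M] :
    ACMData.IsTotallySkew (adaptedACM e).nijenhuis ↔ a₃ = 0 ∧ a₄ = 0 := by
  constructor
  · intro hN
    have hs := h.smooth_frame
    let x : M := Classical.arbitrary M
    -- The symmetric defect of `N` on `(E_1, E_5, E_3)` is `6 a_3`, and on `(E_1, E_5, E_4)` it is
    -- `6 a_4`.
    have h1 := hN _ _ _ (hs 0) (hs 4) (hs 2) x
    have h2 := hN _ _ _ (hs 0) (hs 4) (hs 3) x
    rw [h.nijenhuis_eq (hs _) (hs _), h.nijenhuis_eq (hs _) (hs _)] at h1 h2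
    simp [wedge, h.dual x] at h1 h2
    constructor <;> linarith
  · rintro ⟨rfl, rfl⟩ X Y Z hX hY hZ x
    rw [h.nijenhuis_eq hY hZ, h.nijenhuis_eq hX hZ]
    simp only [wedge]
    ring

theorem isTracelessCyclic_iff [Nonempty M] :
    (adaptedACM e).IsTracelessCyclic (adaptedACM e).nijenhuis ↔ a₁ = 0 ∧ a₂ = 0 := by
  constructor
  · rintro ⟨hN, -⟩
    have hs := h.smooth_frame
    let x : M := Classical.arbitrary M
    -- On the same two triples the cyclic sum of `N` is `12 a_1` and `12 a_2`.
    have h1 := hN _ _ _ (hs 0) (hs 4) (hs 2) x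
    have h2 := hN _ _ _ (hs 0) (hs 4) (hs 3) x
    simp only [h.nijenhuis_eq (hs _) (hs _)] at h1 h2
    simp [wedge, h.dual x] at h1 h2
    constructor <;> linarith
  · rintro ⟨rfl, rfl⟩
    refine ⟨fun X Y Z hX hY hZ x => ?_, fun F X hF hX x hO => ?_⟩
    · rw [h.nijenhuis_eq hY hZ, h.nijenhuis_eq hZ hX, h.nijenhuis_eq hX hY]
      simp only [wedge]
      ring
    · have h04 := orthonormal_sum hO 0 4
      have h14 := orthonormal_sum hO 1 4
      have h24 := orthonormal_sum hO 2 4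
      have h34 := orthonormal_sum hO 3 4
      simp only [Fin.sum_univ_five] at h04 h14 h24 h34
      simp only [h.nijenhuis_eq (hF _) hX, Fin.sum_univ_five, wedge]
      simp at h04 h14 h24 h34
      linear_combination 6 * (a₃ * e 2 x (X x) + a₄ * e 3 x (X x)) * h04
        + 6 * (a₄ * e 2 x (X x) - a₃ * e 3 x (X x)) * h14
        - 6 * (a₃ * e 0 x (X x) + a₄ * e 1 x (X x)) * h24
        + 6 * (a₃ * e 1 x (X x) - a₄ * e 0 x (X x)) * h34

end IsAdaptedFrame

end AdaptedGeometry

/-! ### Connections given by coefficients in a frame. -/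

section FrameConnection

variable {n : ℕ} {N : Type*} [TopologicalSpace N] [ChartedSpace (EuclideanSpace ℝ (Fin n)) N]

lemma d1_swap (σ : OneForm n N) (X Y : VField n N) (x : N) : d1 σ X Y x = - d1 σ Y X x := by
  simp only [d1, lieBr]
  rw [VectorField.mlieBracket_swap_apply, map_neg]
  ring

/-- The coefficients of the Levi-Civita connection in an orthonormal frame `E` dual to `e`. -/
def leviCivitaCoeff (e : Fin n → OneForm n N) (E : Fin n → VField n N) (k i j : Fin n) (x : N) : ℝ :=
  (1 / 2 : ℝ) * (-d1 (e k) (E i) (E j) x + d1 (e j) (E i) (E k) x + d1 (e i) (E j) (E k) x)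

/-- Skewness in the outer indices makes the connection metric. -/
lemma leviCivitaCoeff_antisymm (e : Fin n → OneForm n N) (E : Fin n → VField n N) (k i j : Fin n)
    (x : N) : leviCivitaCoeff e E k i j x = - leviCivitaCoeff e E j i k x := by
  simp only [leviCivitaCoeff]
  rw [d1_swap (e i) (E j) (E k)]
  ring

/-- This is the vanishing of the torsion, in components. -/
lemma leviCivitaCoeff_sub (e : Fin n → OneForm n N) (E : Fin n → VField n N) (k i j : Fin n)
    (x : N) : leviCivitaCoeff e E k i j x - leviCivitaCoeff e E k j i x
      = - d1 (e k) (E i) (E j) x := by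
  simp only [leviCivitaCoeff]
  rw [d1_swap (e k) (E j) (E i)]
  ring

variable [IsManifold (𝓡 n) ∞ N]

/-- The axioms of a covariant derivative concern sections that are merely differentiable, while
smoothness of a form is tested on smooth fields; expansion in a smooth local frame bridges the gap.
-/
lemma mdifferentiableAt_oneForm {σ : OneForm n N}
    (hσ : ∀ x (Y : VField n N), SmoothFieldAt Y x →
      ContMDiffAt (𝓡 n) 𝓘(ℝ, ℝ) ∞ (fun y => σ y (Y y)) x) {Y : VField n N} {x : N}
    (hY : MDifferentiableAt (𝓡 n) (𝓡 n).tangent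
      (fun y => (⟨y, Y y⟩ : TangentBundle (𝓡 n) N)) x) :
    MDifferentiableAt (𝓡 n) 𝓘(ℝ, ℝ) (fun y => σ y (Y y)) x := by
  let b := (EuclideanSpace.basisFun (Fin n) ℝ).toBasis
  let t := trivializationAt (EuclideanSpace ℝ (Fin n)) (TangentSpace (𝓡 n) : N → Type _) x
  have hx : x ∈ t.baseSet := FiberBundle.mem_baseSet_trivializationAt' x
  have hc : ∀ a, MDifferentiableAt (𝓡 n) 𝓘(ℝ, ℝ) (fun y => t.localFrameCoeff (𝓡 n) b a y (Y y)) x :=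
    fun a => mdifferentiableAt_localFrameCoeff b hx hY a
  have hs : ∀ a, MDifferentiableAt (𝓡 n) 𝓘(ℝ, ℝ) (fun y => σ y (t.localFrame b a y)) x :=
    fun a => (hσ x _ (contMDiffAt_localFrame_of_mem ∞ t b a hx)).mdifferentiableAt (by simp)
  have hsum : MDifferentiableAt (𝓡 n) 𝓘(ℝ, ℝ)
      (∑ a, fun y => t.localFrameCoeff (𝓡 n) b a y (Y y) * σ y (t.localFrame b a y)) x :=
    MDifferentiableAt.sum fun a _ => (hc a).mul (hs a)
  refine hsum.congr_of_eventuallyEq ?_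
  filter_upwards [t.eventually_eq_localFrame_sum_coeff_smul (I := 𝓡 n) (s := Y) b hx] with y hy
  conv_lhs => rw [hy]
  simp

/-- The connection `∇_v Y = ∑_k (d(e_k(Y))(v) + ∑_{i,j} c_kij e_i(v) e_j(Y)) E_k`. -/
def frameConnection {e : Fin n → OneForm n N} {E : Fin n → VField n N} (hd : IsDualPair e E)
    (he : ∀ i x (Y : VField n N), SmoothFieldAt Y x →
      ContMDiffAt (𝓡 n) 𝓘(ℝ, ℝ) ∞ (fun y => e i y (Y y)) x)
    (c : Fin n → Fin n → Fin n → N → ℝ) : TangentConnection n N where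
  toFun Y x := ∑ k, (mvfderiv (𝓡 n) (fun y => e k y (Y y)) x
    + ∑ i, ∑ j, (c k i j x * e j x (Y x)) • e i x).smulRight (E k x)
  isCovariantDerivativeOnUniv :=
  { add := by
      intro Y Y' x hY hY' _
      have h1 := fun k => mdifferentiableAt_oneForm (he k) hY
      have h2 := fun k => mdifferentiableAt_oneForm (he k) hY'
      rw [← Finset.sum_add_distrib]
      refine Finset.sum_congr rfl fun k _ => ?_
      have h3 : mvfderiv (𝓡 n) (fun y => e k y ((Y + Y') y)) x
          = mvfderiv (𝓡 n) (fun y => e k y (Y y)) x + mvfderiv (𝓡 n) (fun y => e k y (Y' y)) x := by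
        rw [← mvfderiv_fun_add (h1 k) (h2 k)]
        simp
      rw [h3]
      ext v
      simp [mul_add, add_smul, Finset.sum_add_distrib]
      abel
    leibniz := by
      intro Y f x hY hf _
      have h1 := fun k => mdifferentiableAt_oneForm (he k) hY
      have h3 : ∀ k, mvfderiv (𝓡 n) (fun y => e k y ((f • Y) y)) x
          = f x • mvfderiv (𝓡 n) (fun y => e k y (Y y)) x
            + e k x (Y x) • mvfderiv (𝓡 n) f x := fun k => by
        rw [← mvfderiv_fun_mul hf (h1 k)]
        simp
      ext v
      simp only [h3]
      refine hd.vec_ext fun l => ?_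
      simp only [sum_apply, add_apply, map_sum, map_add,
        ContinuousLinearMap.smulRight_apply, smul_apply, map_smul, hd x l,
        smul_eq_mul, mul_ite, mul_one, mul_zero, Finset.sum_ite_eq, Finset.mem_univ, if_true,
        Pi.smul_apply', mul_add, Finset.mul_sum]
      have h4 : ∀ i j, c l i j x * (f x * e j x (Y x)) * e i x v
          = f x * (c l i j x * e j x (Y x) * e i x v) := fun i j => by ring
      simp only [h4]
      ring }

lemma coframe_frameConnection {e : Fin n → OneForm n N} {E : Fin n → VField n N}
    (hd : IsDualPair e E)
    (he : ∀ i x (Y : VField n N), SmoothFieldAt Y x →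
      ContMDiffAt (𝓡 n) 𝓘(ℝ, ℝ) ∞ (fun y => e i y (Y y)) x)
    (c : Fin n → Fin n → Fin n → N → ℝ) (k : Fin n) (Y : VField n N) (x : N)
    (v : TangentSpace (𝓡 n) x) :
    e k x (frameConnection hd he c Y x v) = mvfderiv (𝓡 n) (fun y => e k y (Y y)) x v
      + ∑ i, ∑ j, c k i j x * e j x (Y x) * e i x v := by
  simp [frameConnection, hd x k]

/-- The exterior derivative of the forms of a smooth coframe is bilinear over functions. -/
lemma d1_eq_sum [NeZero n] {e : Fin n → OneForm n N} {E : Fin n → VField n N}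
    (hd : IsDualPair e E) (hE : ∀ i, SmoothField (E i)) {X Y : VField n N}
    (hX : SmoothField X) (hY : SmoothField Y) (x : N) (k : Fin n) :
    d1 (e k) X Y x = ∑ i, ∑ j, e i x (X x) * e j x (Y x) * d1 (e k) (E i) (E j) x := by
  -- The claim is `d1_pullbackForm` for the identity map.
  have hid : ∀ i, pullbackForm (m := n) (id : N → N) (e i) = e i := by
    intro i
    funext x
    simp only [pullbackForm, mfderiv_id]
    exact ContinuousLinearMap.comp_id _
  have := d1_pullbackForm hd hE contMDiff_id (hX x) (hY x) k
  simpa only [hid, id_eq] using this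

end FrameConnection

/-! ### Existence of the Levi-Civita connection and the Koszul formula. -/

section LeviCivita

variable {M : Type*} [TopologicalSpace M] [ChartedSpace (EuclideanSpace ℝ (Fin 5)) M]
  [IsManifold (𝓡 5) ∞ M]

namespace IsAdaptedFrame

variable {a₁ a₂ a₃ a₄ : ℝ} {e : Fin 5 → OneForm 5 M} {A : OneForm 5 M}
  (h : IsAdaptedFrame a₁ a₂ a₃ a₄ e A (dualFrame e))
include h

theorem exists_isLeviCivita :
    ∃ lc : TangentConnection 5 M, (adaptedACM e).IsLeviCivita lc := by
  refine ⟨frameConnection h.dual h.smooth_coframe_at (leviCivitaCoeff e (dualFrame e)), ?_, ?_⟩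
  · intro X Y Z hX hY hZ x
    rw [h.dirDeriv_ip X hY hZ, adaptedACM_g, adaptedACM_g]
    simp only [coframe_frameConnection]
    have key : ∑ k, (∑ i, ∑ j, leviCivitaCoeff e (dualFrame e) k i j x * e j x (Y x) * e i x (X x))
          * e k x (Z x)
        = - ∑ k, e k x (Y x) * ∑ i, ∑ j,
          leviCivitaCoeff e (dualFrame e) k i j x * e j x (Z x) * e i x (X x) := by
      simp only [Finset.sum_mul, Finset.mul_sum, ← Finset.sum_neg_distrib]
      rw [Finset.sum_comm, Finset.sum_comm (s := Finset.univ (α := Fin 5)) (t := Finset.univ)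
        (f := fun k i => ∑ j, -(e k x (Y x) *
          (leviCivitaCoeff e (dualFrame e) k i j x * e j x (Z x) * e i x (X x))))]
      refine Finset.sum_congr rfl fun i _ => ?_
      rw [Finset.sum_comm]
      refine Finset.sum_congr rfl fun j _ => Finset.sum_congr rfl fun k _ => ?_
      rw [leviCivitaCoeff_antisymm e _ k i j]
      ring
    simp only [add_mul, mul_add, Finset.sum_add_distrib, key, dirDeriv]
    ring
  · intro X Y hX hY x
    refine h.dual.vec_ext fun k => ?_
    rw [map_sub, coframe_frameConnection, coframe_frameConnection, coframe_lieBr,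
      d1_eq_sum h.dual h.smooth_frame hX hY]
    have hD : ∀ i j, d1 (e k) (dualFrame e i) (dualFrame e j) x
        = leviCivitaCoeff e (dualFrame e) k j i x - leviCivitaCoeff e (dualFrame e) k i j x :=
      fun i j => by linarith [leviCivitaCoeff_sub e (dualFrame e) k i j x]
    simp only [hD, dirDeriv]
    have key : ∑ i, ∑ j, leviCivitaCoeff e (dualFrame e) k i j x * e j x (X x) * e i x (Y x)
        = ∑ i, ∑ j, leviCivitaCoeff e (dualFrame e) k j i x * e i x (X x) * e j x (Y x) := by
      rw [Finset.sum_comm]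
    rw [key]
    simp only [mul_sub, Finset.sum_sub_distrib]
    have c1 : ∀ i j, e i x (X x) * e j x (Y x) * leviCivitaCoeff e (dualFrame e) k i j x
      = leviCivitaCoeff e (dualFrame e) k i j x * e j x (Y x) * e i x (X x) := fun i j => by ring
    have c2 : ∀ i j, e i x (X x) * e j x (Y x) * leviCivitaCoeff e (dualFrame e) k j i x
      = leviCivitaCoeff e (dualFrame e) k j i x * e i x (X x) * e j x (Y x) := fun i j => by ring
    simp only [c1, c2]
    ring

/-- The Koszul formula in an adapted frame. -/
theorem leviCivita_eq {lc : TangentConnection 5 M} (hlc : (adaptedACM e).IsLeviCivita lc)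
    {X Y Z : VField 5 M} (hX : SmoothField X) (hY : SmoothField Y) (hZ : SmoothField Z) (x : M) :
    (adaptedACM e).g x (lc Y x (X x)) (Z x) =
      ∑ k, dirDeriv X (fun y => e k y (Y y)) x * e k x (Z x)
      + (1 / 2 : ℝ) * ∑ k, (-(e k x (Z x) * d1 (e k) X Y x) + e k x (Y x) * d1 (e k) X Z x
        + e k x (X x) * d1 (e k) Y Z x) := by
  obtain ⟨hm, ht⟩ := hlc
  have m1 := hm X Y Z hX hY hZ x
  have m2 := hm Y X Z hY hX hZ x
  have m3 := hm Z X Y hZ hX hY x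
  rw [h.dirDeriv_ip _ hY hZ, adaptedACM_g, adaptedACM_g] at m1
  rw [h.dirDeriv_ip _ hX hZ, adaptedACM_g, adaptedACM_g] at m2
  rw [h.dirDeriv_ip _ hX hY, adaptedACM_g, adaptedACM_g] at m3
  have t : ∀ {U W : VField 5 M}, SmoothField U → SmoothField W → ∀ k,
      e k x (lc W x (U x)) - e k x (lc U x (W x)) = dirDeriv U (fun y => e k y (W y)) x
        - dirDeriv W (fun y => e k y (U y)) x - d1 (e k) U W x := by
    intro U W hU hW k
    rw [← map_sub, ht U W hU hW, coframe_lieBr]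
  have s1 : ∀ {u w : Fin 5 → ℝ} (z : Fin 5 → ℝ), (∀ k, u k = w k) →
      ∑ k, u k * z k = ∑ k, w k * z k := fun z huw => by simp only [huw]
  have t1 := s1 (fun k => e k x (Z x)) (t hX hY)
  have t2 := s1 (fun k => e k x (Y x)) (t hX hZ)
  have t3 := s1 (fun k => e k x (X x)) (t hY hZ)
  rw [adaptedACM_g]
  simp only [Fin.sum_univ_five] at *
  linarith

end IsAdaptedFrame

end LeviCivita

/-! ### The canonical connection has connection form `A_2 ⊗ F`. -/

section CanonicalConnection

variable {M : Type*} [TopologicalSpace M] [ChartedSpace (EuclideanSpace ℝ (Fin 5)) M]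
  [IsManifold (𝓡 5) ∞ M]

namespace IsAdaptedFrame

variable {a₁ a₂ a₃ a₄ : ℝ} {e : Fin 5 → OneForm 5 M} {A : OneForm 5 M}
  (h : IsAdaptedFrame a₁ a₂ a₃ a₄ e A (dualFrame e))
include h

lemma gammaForm_eq {X Y : VField 5 M} (hX : SmoothField X) (hY : SmoothField Y) (x : M) :
    (adaptedACM e).gammaForm X Y x =
      2 * (2 * a₁ + a₃) * (e 0 x (X x) * e 2 x (Y x) - e 1 x (X x) * e 3 x (Y x)
        - e 2 x (X x) * e 0 x (Y x) + e 3 x (X x) * e 1 x (Y x))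
      + 2 * (2 * a₂ + a₄) * (e 0 x (X x) * e 3 x (Y x) + e 1 x (X x) * e 2 x (Y x)
        - e 2 x (X x) * e 1 x (Y x) - e 3 x (X x) * e 0 x (Y x)) := by
  have hξ : (adaptedACM e).ξ = dualFrame e 4 := rfl
  have hs := h.smooth_frame 4
  have hφ := h.smoothField_ap hX
  rw [ACMData.gammaForm, hξ, h.d2_fundForm hs hφ hY]
  simp only [h.d_zero _ _ hs hφ, h.d_zero _ _ hs hY, h.d_zero _ _ hφ hY, h.d_one _ _ hs hφ,
    h.d_one _ _ hs hY, h.d_one _ _ hφ hY, h.d_two _ _ hs hφ, h.d_two _ _ hs hY,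
    h.d_two _ _ hφ hY, h.d_three _ _ hs hφ, h.d_three _ _ hs hY, h.d_three _ _ hφ hY, wedge,
    ACMData.ap, coframe_φ_zero h.dual, coframe_φ_one h.dual, coframe_φ_two h.dual,
    coframe_φ_three h.dual, coframe_φ_four h.dual, h.dual x]
  simp
  ring

/-- The canonical tensor is minus the Koszul term of the Levi-Civita connection, up to `A ⊗ F`. -/
lemma canonicalTensor_eq {X Y Z : VField 5 M} (hX : SmoothField X) (hY : SmoothField Y)
    (hZ : SmoothField Z) (x : M) :
    (1 / 2 : ℝ) * ∑ k, (-(e k x (Z x) * d1 (e k) X Y x) + e k x (Y x) * d1 (e k) X Z x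
      + e k x (X x) * d1 (e k) Y Z x) + (adaptedACM e).canonicalTensor X Y Z x
      = A x (X x) * formF e x (Y x) (Z x) := by
  have hη : (adaptedACM e).η = e 4 := rfl
  rw [ACMData.canonicalTensor, h.nijenhuis_eq hY hZ, h.gammaForm_eq hX hY, h.gammaForm_eq hX hZ,
    h.gammaForm_eq hY hZ, hη]
  simp only [Fin.sum_univ_five, h.d_zero _ _ hX hY, h.d_zero _ _ hX hZ, h.d_zero _ _ hY hZ,
    h.d_one _ _ hX hY, h.d_one _ _ hX hZ, h.d_one _ _ hY hZ, h.d_two _ _ hX hY,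
    h.d_two _ _ hX hZ, h.d_two _ _ hY hZ, h.d_three _ _ hX hY, h.d_three _ _ hX hZ,
    h.d_three _ _ hY hZ, h.d_four _ _ hX hY, h.d_four _ _ hX hZ, h.d_four _ _ hY hZ, wedge, formF,
    Pi.sub_apply]
  ring

/-- The Koszul term and the canonical tensor add up to `A ⊗ F`, so the Levi-Civita connection
disappears from the description. This gives both the existence of `∇^c` and its explicit form. -/
lemma isCanonicalConnection_iff {cov : TangentConnection 5 M} :
    (adaptedACM e).IsCanonicalConnection cov ↔
      ∀ X Y Z : VField 5 M, SmoothField X → SmoothField Y → SmoothField Z → ∀ x,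
        (adaptedACM e).g x (cov Y x (X x)) (Z x) =
          ∑ k, dirDeriv X (fun y => e k y (Y y)) x * e k x (Z x)
            + A x (X x) * formF e x (Y x) (Z x) := by
  constructor
  · rintro ⟨lc, hlc, hc⟩ X Y Z hX hY hZ x
    rw [hc X Y Z hX hY hZ, h.leviCivita_eq hlc hX hY hZ, ← h.canonicalTensor_eq hX hY hZ]
    ring
  · intro hc
    obtain ⟨lc, hlc⟩ := h.exists_isLeviCivita
    refine ⟨lc, hlc, fun X Y Z hX hY hZ x => ?_⟩
    rw [hc X Y Z hX hY hZ, h.leviCivita_eq hlc hX hY hZ, ← h.canonicalTensor_eq hX hY hZ]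
    ring

lemma formF_eq_sum (x : M) (v w : TangentSpace (𝓡 5) x) :
    formF e x v w = ∑ k, formF e x v (dualFrame e k x) * e k x w := by
  simp [formF, wedge, h.dual x, Fin.sum_univ_five]
  ring

theorem exists_isCanonicalConnection :
    ∃ cov : TangentConnection 5 M, (adaptedACM e).IsCanonicalConnection cov := by
  refine ⟨frameConnection h.dual h.smooth_coframe_at fun k i j x =>
    A x (dualFrame e i x) * formF e x (dualFrame e j x) (dualFrame e k x),
    h.isCanonicalConnection_iff.mpr fun X Y Z hX hY hZ x => ?_⟩
  have hA : A x (X x) = ∑ i, A x (dualFrame e i x) * e i x (X x) := by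
    conv_lhs => rw [h.dual.eq_sum x (X x)]
    simp [mul_comm]
  rw [adaptedACM_g]
  simp only [coframe_frameConnection, add_mul, Finset.sum_add_distrib, dirDeriv]
  congr 1
  rw [h.formF_eq_sum, Finset.mul_sum]
  refine Finset.sum_congr rfl fun k _ => ?_
  rw [hA]
  simp only [formF, wedge, Pi.sub_apply, h.dual x, Fin.sum_univ_five]
  fin_cases k <;> simp <;> ring

variable {cov : TangentConnection 5 M} (hcov : (adaptedACM e).IsCanonicalConnection cov)
include hcov

/-- The canonical connection in coordinates. -/
lemma coframe_cov {Y : VField 5 M} (hY : SmoothField Y) (k : Fin 5) (x : M)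
    (v : TangentSpace (𝓡 5) x) : e k x (cov Y x v) =
      mvfderiv (𝓡 5) (fun y => e k y (Y y)) x v + A x v * formF e x (Y x) (dualFrame e k x) := by
  obtain ⟨X, hX, rfl⟩ := h.smoothField_const x v
  have := h.isCanonicalConnection_iff.mp hcov X Y _ hX hY (h.smooth_frame k) x
  rw [adaptedACM_g] at this
  simpa [h.dual x, dirDeriv] using this

lemma cov_frame (i j : Fin 5) (x : M) (v : TangentSpace (𝓡 5) x) :
    (adaptedACM e).g x (cov (dualFrame e i) x v) (dualFrame e j x)
      = A x v * formF e x (dualFrame e i x) (dualFrame e j x) := by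
  rw [adaptedACM_g]
  simp only [h.coframe_cov hcov (h.smooth_frame i), h.dual _ _ i, h.dual _ _ j]
  simp [mvfderiv_const]

theorem isMetricConnection : (adaptedACM e).IsMetricConnection cov := by
  intro X Y Z hX hY hZ x
  rw [h.dirDeriv_ip X hY hZ, adaptedACM_g, adaptedACM_g]
  simp only [h.coframe_cov hcov hY, h.coframe_cov hcov hZ, Fin.sum_univ_five, dirDeriv, formF,
    wedge, Pi.sub_apply, h.dual x]
  simp
  ring

/-- The endomorphism belonging to `F` kills `E_5` and rotates the planes of `E_1, E_2` and of `E_3,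
E_4`, as `φ` does; hence it commutes with `φ`. -/
theorem isCompatible : (adaptedACM e).IsCompatible cov := by
  have hξ : (adaptedACM e).ξ = dualFrame e 4 := rfl
  have hη : (adaptedACM e).η = e 4 := rfl
  refine ⟨fun x v => ?_, fun X Y hX hY x => ?_, fun X Y hX hY x => ?_⟩
  · refine h.dual.vec_ext fun k => ?_
    rw [hξ, h.coframe_cov hcov (h.smooth_frame 4)]
    simp [formF, wedge, h.dual _ _ 4, mvfderiv_const]
  · rw [hη, h.coframe_cov hcov hY]
    simp [formF, wedge, h.dual x, dirDeriv]
  · refine h.dual.vec_ext fun k => ?_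
    rw [map_sub, h.coframe_cov hcov (h.smoothField_ap hY)]
    fin_cases k
    all_goals
      simp [mvfderiv_const, mvfderiv_fun_neg, coframe_φ_zero h.dual,
        coframe_φ_one h.dual, coframe_φ_two h.dual, coframe_φ_three h.dual, coframe_φ_four h.dual, h.coframe_cov hcov hY, ACMData.ap, formF,
        wedge, h.dual x]
      try ring

end IsAdaptedFrame

end CanonicalConnection

/-! ### Curvature and Ricci tensor of the canonical connection. -/

section CanonicalCurvature

variable {M : Type*} [TopologicalSpace M] [ChartedSpace (EuclideanSpace ℝ (Fin 5)) M]
  [IsManifold (𝓡 5) ∞ M]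

namespace IsAdaptedFrame

variable {a₁ a₂ a₃ a₄ : ℝ} {e : Fin 5 → OneForm 5 M} {A : OneForm 5 M}
  (h : IsAdaptedFrame a₁ a₂ a₃ a₄ e A (dualFrame e))
include h

lemma smoothFun_formF {X Y : VField 5 M} (hX : SmoothField X) (hY : SmoothField Y) :
    SmoothFun 5 (fun y => formF e y (X y) (Y y)) :=
  (h.smoothFun_wedge hX hY 0 1).sub (h.smoothFun_wedge hX hY 2 3)

variable {cov : TangentConnection 5 M} (hcov : (adaptedACM e).IsCanonicalConnection cov)
include hcov

lemma smoothField_covAlong {X Y : VField 5 M} (hX : SmoothField X) (hY : SmoothField Y) :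
    SmoothField (covAlong cov X Y) := by
  refine h.smoothField_of_coframe fun k => ?_
  simp only [covAlong, h.coframe_cov hcov hY]
  exact ((h.smooth_coframe k Y hY).dirDeriv hX).add
    ((h.smooth_conn X hX).mul (h.smoothFun_formF hY (h.smooth_frame k)))

/-- Each `F(·, E_k)` is zero or some `± e_l`, so the connection formula applies to it. The constant
comes from the square of `F`, which is `-1` orthogonally to `ξ` and `0` on `ξ`. What matters is that
`c` does not depend on `v`. -/
lemma formF_cov {Y : VField 5 M} (hY : SmoothField Y) (k : Fin 5) (x : M) :
    ∃ c : ℝ, ∀ v : TangentSpace (𝓡 5) x, formF e x (cov Y x v) (dualFrame e k x) =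
      mvfderiv (𝓡 5) (fun y => formF e y (Y y) (dualFrame e k y)) x v + A x v * c := by
  refine ⟨if k = 4 then 0 else - e k x (Y x), fun v => ?_⟩
  fin_cases k
  all_goals
    simp [formF, wedge, h.dual _, h.coframe_cov hcov hY, mvfderiv_const, mvfderiv_fun_neg]
    try ring

/-- With connection form `A ⊗ F` and `F` constant in the frame, the quadratic term `A ∧ A` vanishes
and only `dA ⊗ F` survives. -/
lemma coframe_curvature {X Y Z : VField 5 M} (hX : SmoothField X) (hY : SmoothField Y)
    (hZ : SmoothField Z) (k : Fin 5) (x : M) :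
    e k x (curvature cov X Y Z x) = alphaConst a₁ a₂ a₃ a₄ *
      (formF e x (X x) (Y x) * formF e x (Z x) (dualFrame e k x)) := by
  obtain ⟨c, hc⟩ := h.formF_cov hcov hZ k x
  have hk := h.smooth_coframe k Z hZ
  have hf := h.smoothFun_formF hZ (h.smooth_frame k)
  -- Only the first two terms on the right fail to be symmetric in `U`, `V`. Their skew parts
  -- combine with the `[X,Y]` term to give the commutator identity and `dA`.
  have key : ∀ {U V : VField 5 M}, SmoothField U → SmoothField V →
      e k x (covAlong cov U (covAlong cov V Z) x) =
        dirDeriv U (dirDeriv V (fun y => e k y (Z y))) x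
        + dirDeriv U (fun y => A y (V y)) x * formF e x (Z x) (dualFrame e k x)
        + A x (V x) * dirDeriv U (fun y => formF e y (Z y) (dualFrame e k y)) x
        + A x (U x) * dirDeriv V (fun y => formF e y (Z y) (dualFrame e k y)) x
        + A x (U x) * A x (V x) * c := by
    intro U V hU hV
    rw [covAlong, h.coframe_cov hcov (h.smoothField_covAlong hcov hV hZ)]
    have h1 : (fun y => e k y (covAlong cov V Z y)) = fun y =>
        dirDeriv V (fun y => e k y (Z y)) y
          + A y (V y) * formF e y (Z y) (dualFrame e k y) :=
      funext fun y => h.coframe_cov hcov hZ k y (V y)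
    have h2 := dirDeriv_add U ((hk.dirDeriv hV).mdifferentiableAt x)
      (((h.smooth_conn V hV).mul hf).mdifferentiableAt x)
    have h3 := dirDeriv_mul U ((h.smooth_conn V hV).mdifferentiableAt x) (hf.mdifferentiableAt x)
    rw [h3, ← h1] at h2
    have h4 := hc (V x)
    simp only [dirDeriv, covAlong] at h2 h4 ⊢
    rw [h2, h4]
    ring
  have hA := h.d_conn X Y hX hY x
  have hbr := dirDeriv_lieBr (hX x) (hY x) (hk x)
  simp only [curvature, Pi.sub_apply, map_sub]
  rw [key hX hY, key hY hX, covAlong, h.coframe_cov hcov hZ]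
  have hF : formF e x (X x) (Y x) = wedge (e 0) (e 1) x (X x) (Y x)
    - wedge (e 2) (e 3) x (X x) (Y x) := rfl
  rw [hF, ← mul_assoc, ← hA, d1]
  simp only [dirDeriv] at hbr ⊢
  rw [hbr]
  ring

/-- The curvature of the canonical connection is `α F ⊗ F`. -/
theorem ip_curvature {X Y Z : VField 5 M} (hX : SmoothField X) (hY : SmoothField Y)
    (hZ : SmoothField Z) (W : VField 5 M) (x : M) :
    (adaptedACM e).ip (curvature cov X Y Z) W x = alphaConst a₁ a₂ a₃ a₄ *
      (formF e x (X x) (Y x) * formF e x (Z x) (W x)) := by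
  rw [adaptedACM_ip, h.formF_eq_sum x (Z x) (W x), Finset.mul_sum, Finset.mul_sum]
  refine Finset.sum_congr rfl fun k _ => ?_
  rw [h.coframe_curvature hcov hX hY hZ]
  ring

theorem curvature_ξ {X Y : VField 5 M} (hX : SmoothField X) (hY : SmoothField Y) (x : M) :
    curvature cov X Y (adaptedACM e).ξ x = 0 := by
  have hξ : (adaptedACM e).ξ = dualFrame e 4 := rfl
  refine h.dual.vec_ext fun k => ?_
  rw [hξ, h.coframe_curvature hcov hX hY (h.smooth_frame 4)]
  simp [formF, wedge, h.dual x]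

theorem curvature_ap {X Y Z : VField 5 M} (hX : SmoothField X) (hY : SmoothField Y)
    (hZ : SmoothField Z) (x : M) :
    curvature cov X Y ((adaptedACM e).ap Z) x = (adaptedACM e).ap (curvature cov X Y Z) x := by
  refine h.dual.vec_ext fun k => ?_
  rw [h.coframe_curvature hcov hX hY (h.smoothField_ap hZ)]
  fin_cases k
  all_goals
    simp [ACMData.ap, formF, wedge, h.dual x, coframe_φ_zero h.dual, coframe_φ_one h.dual,
      coframe_φ_two h.dual, coframe_φ_three h.dual, coframe_φ_four h.dual,
      h.coframe_curvature hcov hX hY hZ]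

theorem ip_curvature_skew {X Y Z W : VField 5 M} (hX : SmoothField X) (hY : SmoothField Y)
    (hZ : SmoothField Z) (hW : SmoothField W) (x : M) :
    (adaptedACM e).ip (curvature cov X Y Z) W x
      = -(adaptedACM e).ip Z (curvature cov X Y W) x := by
  have hs : (adaptedACM e).ip Z (curvature cov X Y W) x
      = (adaptedACM e).ip (curvature cov X Y W) Z x := h.isAlmostContactMetric.g_symm _ _ _
  rw [hs, h.ip_curvature hcov hX hY hZ, h.ip_curvature hcov hX hY hW]
  simp only [formF, wedge, Pi.sub_apply]
  ring

theorem curvatureOperator_eq {Z : VField 5 M} (hZ : SmoothField Z) (W : VField 5 M)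
    (β : TwoForm 5 M) (x : M) :
    curvatureOperator (adaptedACM e) (dualFrame e) cov β Z W x =
      (2 * alphaConst a₁ a₂ a₃ a₄) * (formInner (dualFrame e) β (formF e) x
        / formInner (dualFrame e) (formF e) (formF e) x * formF e x (Z x) (W x)) := by
  -- The norm `|F|² = 2` accounts for the factor `2α` in front of the projection.
  have h2 : formInner (dualFrame e) (formF e) (formF e) x = 2 := by
    have hI0 : Finset.Ioi (0 : Fin 5) = {1, 2, 3, 4} := by decide
    have hI1 : Finset.Ioi (1 : Fin 5) = {2, 3, 4} := by decide
    have hI2 : Finset.Ioi (2 : Fin 5) = {3, 4} := by decide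
    have hI3 : Finset.Ioi (3 : Fin 5) = {4} := by decide
    have hI4 : Finset.Ioi (4 : Fin 5) = ∅ := by decide
    simp [formInner, Fin.sum_univ_five, hI0, hI1, hI2, hI3, hI4, formF, wedge, h.dual x]
    norm_num
  rw [h2]
  simp only [curvatureOperator, formInner,
    h.ip_curvature hcov (h.smooth_frame _) (h.smooth_frame _) hZ, div_mul_eq_mul_div,
    Finset.sum_mul, Finset.mul_sum, Finset.sum_div]
  refine Finset.sum_congr rfl fun i _ => Finset.sum_congr rfl fun j _ => ?_
  ring

/-- The contraction is `α` times the square of the endomorphism of `F`. -/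
theorem ricci_eq (i j : Fin 5) (x : M) :
    ricci (adaptedACM e) (dualFrame e) cov (dualFrame e i) (dualFrame e j) x =
      -alphaConst a₁ a₂ a₃ a₄ *
        Matrix.diagonal (![1, 1, 1, 1, 0] : Fin 5 → ℝ) i j := by
  simp only [ricci, h.ip_curvature hcov (h.smooth_frame _) (h.smooth_frame _) (h.smooth_frame _)]
  fin_cases i <;> fin_cases j <;>
    simp [formF, wedge, h.dual x, Matrix.diagonal]

end IsAdaptedFrame

end CanonicalCurvature

/-! ### Parallel spinors. -/

section Spinors

namespace SpinRep

lemma gen_sq (ρ : SpinRep) (i : Fin 5) : ρ.gen i * ρ.gen i = -1 := by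
  have hq : cliffordForm (Pi.single i 1) = -1 := by
    simp [cliffordForm, QuadraticMap.weightedSumSquares_apply, Pi.single_apply]
  rw [gen, ← map_mul, CliffordAlgebra.ι_sq_scalar, hq]
  simp

lemma gen_mul_gen_swap (ρ : SpinRep) {i j : Fin 5} (hij : i ≠ j) :
    ρ.gen i * ρ.gen j = -(ρ.gen j * ρ.gen i) := by
  have hq : QuadraticMap.polar cliffordForm (Pi.single i 1) (Pi.single j 1) = 0 := by
    simp only [QuadraticMap.polar, cliffordForm, QuadraticMap.weightedSumSquares_apply,
      ← Finset.sum_sub_distrib]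
    refine Finset.sum_eq_zero fun k _ => ?_
    rcases eq_or_ne k i with rfl | hk
    · simp [hij]
    · simp [Pi.single_apply, hk]
  rw [eq_neg_iff_add_eq_zero, gen, gen, ← map_mul ρ, ← map_mul ρ, ← map_add,
    CliffordAlgebra.ι_mul_ι_add_swap, hq, map_zero, map_zero]

end SpinRep

/-- If `a² = b² = -1`, `ab = ba` and some `c` with `c² = -1` anticommutes with `a` and commutes
with `b`, then the kernel of `a - b` has at least half of the full dimension. -/
lemma exists_linearIndependent_mulVec_sub_eq_zero {a b c : Matrix (Fin 4) (Fin 4) ℂ}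
    (ha : a * a = -1) (hb : b * b = -1) (hab : a * b = b * a) (hc : c * c = -1)
    (hca : c * a = -(a * c)) (hcb : c * b = b * c) :
    ∃ ψ₁ ψ₂ : Fin 4 → ℂ, (a - b).mulVec ψ₁ = 0 ∧ (a - b).mulVec ψ₂ = 0 ∧
      LinearIndependent ℂ ![ψ₁, ψ₂] := by
  have h0 : (a - b) * (a + b) = 0 := by
    rw [sub_mul, mul_add, mul_add, ha, hb, hab]; abel
  -- Multiplying by `c` on both sides fixes `a` and changes the sign of `b`.
  have h1 : (a - b).rank ≤ (a + b).rank := by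
    have : a - b = c * ((a + b) * c) := by
      rw [add_mul, ← hcb, ← neg_neg (a * c), ← hca, mul_add, mul_neg, ← mul_assoc, ← mul_assoc, hc]
      simp [sub_eq_add_neg]
    rw [this]
    exact (Matrix.rank_mul_le_right _ _).trans (Matrix.rank_mul_le_left _ _)
  -- The two matrices add up to the invertible matrix `2a`; with `h1`, the rank of `a + b` is at
  -- least 2.
  have h2 : 4 ≤ (a + b).rank + (a - b).rank := by
    have : (1 : Matrix (Fin 4) (Fin 4) ℂ) = ((-1 / 2 : ℂ) • a) * ((a + b) + (a - b)) := by
      rw [add_add_sub_cancel, Matrix.smul_mul, mul_add, ha, ← two_smul ℂ, smul_smul, smul_neg]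
      norm_num
    calc 4 = (1 : Matrix (Fin 4) (Fin 4) ℂ).rank := by simp
      _ ≤ ((a + b) + (a - b)).rank := by
        rw [this]
        exact Matrix.rank_mul_le_right _ _
      _ ≤ _ := by
        rw [Matrix.rank, Matrix.mulVecLin_add]
        refine (Submodule.finrank_mono ?_).trans (Submodule.finrank_add_le_finrank_add_finrank _ _)
        rintro _ ⟨v, rfl⟩
        exact Submodule.add_mem_sup ⟨v, rfl⟩ ⟨v, rfl⟩
  have h3 : 2 ≤ Module.finrank ℂ (LinearMap.ker (a - b).mulVecLin) := by
    have : LinearMap.range (a + b).mulVecLin ≤ LinearMap.ker (a - b).mulVecLin := by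
      rintro _ ⟨v, rfl⟩
      rw [LinearMap.mem_ker, Matrix.mulVecLin_apply, Matrix.mulVecLin_apply, Matrix.mulVec_mulVec, h0,
        Matrix.zero_mulVec]
    have h4 : (a + b).rank ≤ _ := Submodule.finrank_mono this
    omega
  obtain ⟨f, hf⟩ := exists_linearIndependent_of_le_finrank h3
  refine ⟨f 0, f 1, (f 0).2, (f 1).2, ?_⟩
  have := hf.map' (Submodule.subtype _) (Submodule.ker_subtype _)
  have hv : ![(f 0 : Fin 4 → ℂ), f 1] = Submodule.subtype _ ∘ f := by
    ext i
    fin_cases i <;> rfl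
  rw [hv]
  exact this

/-- The preceding lemma applies with `a = e_1e_2`, `b = e_3e_4`, `c = e_1`; only the Clifford
relations enter, so no explicit matrices are needed. -/
lemma SpinRep.exists_linearIndependent_spinors (ρ : SpinRep) :
    ∃ ψ₁ ψ₂ : Fin 4 → ℂ, (ρ.gen 0 * ρ.gen 1 - ρ.gen 2 * ρ.gen 3).mulVec ψ₁ = 0 ∧
      (ρ.gen 0 * ρ.gen 1 - ρ.gen 2 * ρ.gen 3).mulVec ψ₂ = 0 ∧
      LinearIndependent ℂ ![ψ₁, ψ₂] := by
  have s : ∀ i j : Fin 5, i ≠ j → ρ.gen i * ρ.gen j = -(ρ.gen j * ρ.gen i) :=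
    fun i j => ρ.gen_mul_gen_swap
  have comm : ∀ i j k : Fin 5, k ≠ i → k ≠ j →
      ρ.gen k * (ρ.gen i * ρ.gen j) = ρ.gen i * ρ.gen j * ρ.gen k := by
    intro i j k hi hj
    rw [← mul_assoc, s k i hi, neg_mul, mul_assoc, s k j hj, mul_neg, neg_neg, mul_assoc]
  have sq : ∀ i j : Fin 5, i ≠ j → ρ.gen i * ρ.gen j * (ρ.gen i * ρ.gen j) = -1 := by
    intro i j hij
    rw [mul_assoc, ← mul_assoc (ρ.gen j), s j i hij.symm, neg_mul, mul_assoc, ρ.gen_sq j, mul_neg,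
      mul_neg, mul_neg, mul_one, neg_neg, ρ.gen_sq i]
  refine exists_linearIndependent_mulVec_sub_eq_zero (sq 0 1 (by decide)) (sq 2 3 (by decide)) ?_
    (ρ.gen_sq 0) ?_ (comm 2 3 0 (by decide) (by decide))
  · rw [mul_assoc, comm 2 3 1 (by decide) (by decide), ← mul_assoc,
      comm 2 3 0 (by decide) (by decide), mul_assoc]
  · rw [mul_assoc, s 1 0 (by decide), mul_neg, neg_neg]

variable {M : Type*} [TopologicalSpace M] [ChartedSpace (EuclideanSpace ℝ (Fin 5)) M]

/-- Used twice: with `s = A(v)` for the spinorial connection form and with `s = 1` for the Clifford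
product by `F`. -/
lemma IsDualPair.sum_formF_smul {e : Fin 5 → OneForm 5 M} (h : IsDualPair e (dualFrame e))
    (ρ : SpinRep) (ψ : Fin 4 → ℂ) (s : ℝ) (x : M) :
    ∑ i, ∑ j ∈ Finset.Ioi i, (s * formF e x (dualFrame e i x) (dualFrame e j x)) •
      (ρ.gen i * ρ.gen j).mulVec ψ
      = s • (ρ.gen 0 * ρ.gen 1 - ρ.gen 2 * ρ.gen 3).mulVec ψ := by
  have hI0 : Finset.Ioi (0 : Fin 5) = {1, 2, 3, 4} := by decide
  have hI1 : Finset.Ioi (1 : Fin 5) = {2, 3, 4} := by decide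
  have hI2 : Finset.Ioi (2 : Fin 5) = {3, 4} := by decide
  have hI3 : Finset.Ioi (3 : Fin 5) = {4} := by decide
  have hI4 : Finset.Ioi (4 : Fin 5) = ∅ := by decide
  simp [Fin.sum_univ_five, hI0, hI1, hI2, hI3, hI4, formF, wedge, h x, Matrix.sub_mulVec, smul_sub]
  rw [← sub_eq_add_neg]

/-- Both spinor fields are constant in the frame. Being annihilated by `F` makes their covariant
derivatives vanish, since the connection form acts through `F` alone. -/
theorem IsAdaptedFrame.exists_parallel_spinors [IsManifold (𝓡 5) ∞ M] {a₁ a₂ a₃ a₄ : ℝ}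
    {e : Fin 5 → OneForm 5 M} {A : OneForm 5 M}
    (h : IsAdaptedFrame a₁ a₂ a₃ a₄ e A (dualFrame e)) {cov : TangentConnection 5 M}
    (hcov : (adaptedACM e).IsCanonicalConnection cov) (ρ : SpinRep) :
    ∃ ψ₁ ψ₂ : M → (Fin 4 → ℂ),
      IsParallelSpinor ρ (adaptedACM e) (dualFrame e) cov ψ₁ ∧
      IsParallelSpinor ρ (adaptedACM e) (dualFrame e) cov ψ₂ ∧
      (∀ x, cliffordMul ρ (dualFrame e) (formF e) ψ₁ x = 0 ∧
        cliffordMul ρ (dualFrame e) (formF e) ψ₂ x = 0) ∧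
      ∀ x, LinearIndependent ℂ ![ψ₁ x, ψ₂ x] := by
  obtain ⟨ψ₁, ψ₂, h1, h2, hind⟩ := ρ.exists_linearIndependent_spinors
  have hpar : ∀ ψ : Fin 4 → ℂ, (ρ.gen 0 * ρ.gen 1 - ρ.gen 2 * ρ.gen 3).mulVec ψ = 0 →
      IsParallelSpinor ρ (adaptedACM e) (dualFrame e) cov fun _ => ψ := by
    refine fun ψ hψ => ⟨contMDiff_const, fun x v => ?_⟩
    simp only [spinDeriv, h.cov_frame hcov, h.dual.sum_formF_smul, hψ, mvfderiv_const]
    simp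
  have hcl : ∀ ψ : Fin 4 → ℂ, (ρ.gen 0 * ρ.gen 1 - ρ.gen 2 * ρ.gen 3).mulVec ψ = 0 →
      ∀ x, cliffordMul ρ (dualFrame e) (formF e) (fun _ => ψ) x = 0 := by
    intro ψ hψ x
    simpa [cliffordMul, hψ] using h.dual.sum_formF_smul ρ ψ 1 x
  exact ⟨fun _ => ψ₁, fun _ => ψ₂, hpar ψ₁ h1, hpar ψ₂ h2, fun x => ⟨hcl ψ₁ h1 x, hcl ψ₂ h2 x⟩,
    fun _ => hind⟩

end Spinors

end

theorem theorem3 (a₁ a₂ a₃ a₄ : ℝ) (ha : a₁ * a₄ = a₂ * a₃)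
    {G : Type*} [TopologicalSpace G] [ChartedSpace (EuclideanSpace ℝ (Fin 6)) G] [Group G]
    [LieGroup (𝓡 6) ∞ G]
    (θ : Fin 6 → OneForm 6 G) (hθ : IsStructureCoframe a₁ a₂ a₃ a₄ θ)
    {M : Type*} [TopologicalSpace M] [ChartedSpace (EuclideanSpace ℝ (Fin 5)) M]
    [IsManifold (𝓡 5) ∞ M] [Nonempty M]
    (ι : M → G) (hι : ContMDiff (𝓡 5) (𝓡 6) ∞ ι)
    (hind : ∀ x, LinearIndependent ℝ (fun i => restrictedCoframe θ ι i x))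
    (e : Fin 5 → OneForm 5 M) (he : e = restrictedCoframe θ ι)
    (E : Fin 5 → VField 5 M) (hE : E = dualFrame e)
    (S : ACMData 5 M) (hS : S = adaptedACM e)
    (F : TwoForm 5 M) (hF : F = formF e)
    (α : ℝ) (hα : α = alphaConst a₁ a₂ a₃ a₄) :
    -- the manifold is generalized quasi-Sasaki
    S.IsGeneralizedQuasiSasaki ∧
    -- a) the Nijenhuis tensor
    (∀ X Y : VField 5 M, SmoothField X → SmoothField Y → ∀ x,
      S.nijenhuis S.ξ X Y x = 2 * d1 S.η X Y x) ∧
    (ACMData.IsTotallySkew S.nijenhuis ↔ a₃ = 0 ∧ a₄ = 0) ∧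
    (S.IsTracelessCyclic S.nijenhuis ↔ a₁ = 0 ∧ a₂ = 0) ∧
    -- b) `F` is closed
    (∀ X Y Z : VField 5 M, SmoothField X → SmoothField Y → SmoothField Z → ∀ x,
      d2 F X Y Z x = 0) ∧
    -- the connection `∇^c` exists
    (∃ cov : TangentConnection 5 M, S.IsCanonicalConnection cov) ∧
    (∀ cov : TangentConnection 5 M, S.IsCanonicalConnection cov →
      -- `∇^c` is a metric connection compatible with the almost contact metric structure
      S.IsMetricConnection cov ∧ S.IsCompatible cov ∧
      -- c) the curvature takes values in `𝔲(2)`, the skew-symmetric endomorphisms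
      -- that annihilate `ξ` and commute with `φ`
      (∀ X Y Z W : VField 5 M, SmoothField X → SmoothField Y → SmoothField Z → SmoothField W →
        ∀ x, S.ip (curvature cov X Y Z) W x = -S.ip Z (curvature cov X Y W) x ∧
          curvature cov X Y S.ξ x = 0 ∧
          curvature cov X Y (S.ap Z) x = S.ap (curvature cov X Y Z) x) ∧
      -- `R^c = α F ⊗ F`
      (∀ X Y Z W : VField 5 M, SmoothField X → SmoothField Y → SmoothField Z → SmoothField W →
        ∀ x, S.ip (curvature cov X Y Z) W x = α * (F x (X x) (Y x) * F x (Z x) (W x))) ∧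
      -- `R^c` is `2 α` times the orthogonal projection onto the span of `F`
      (∀ b : BilinField 5 M, (∀ x v, b x v v = 0) → ∀ β : TwoForm 5 M, (∀ x v w, β x v w = b x v w) →
        ∀ Z W : VField 5 M, SmoothField Z → SmoothField W → ∀ x,
          curvatureOperator S E cov β Z W x =
            (2 * α) * (formInner E β F x / formInner E F F x * F x (Z x) (W x))) ∧
      -- d) the Ricci tensor in the frame `E`
      (∀ i j x, ricci S E cov (E i) (E j) x =
        -α * Matrix.diagonal (![1, 1, 1, 1, 0] : Fin 5 → ℝ) i j) ∧
      -- e) two parallel spinor fields, linearly independent at each point, with `F · ψ = 0`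
      (∀ ρ : SpinRep, ∃ ψ₁ ψ₂ : M → (Fin 4 → ℂ),
        IsParallelSpinor ρ S E cov ψ₁ ∧ IsParallelSpinor ρ S E cov ψ₂ ∧
        (∀ x, cliffordMul ρ E F ψ₁ x = 0 ∧ cliffordMul ρ E F ψ₂ x = 0) ∧
        ∀ x, LinearIndependent ℂ ![ψ₁ x, ψ₂ x])) := by
  subst he hE hS hF hα
  have h := isAdaptedFrame_restrictedCoframe hθ hι hind
  refine ⟨h.isGeneralizedQuasiSasaki, fun X Y hX hY x => h.nijenhuis_ξ hX hY x,
    h.isTotallySkew_iff, h.isTracelessCyclic_iff, fun X Y Z hX hY hZ x => h.d2_formF hX hY hZ x,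
    h.exists_isCanonicalConnection, fun cov hcov => ⟨h.isMetricConnection hcov,
      h.isCompatible hcov, fun X Y Z W hX hY hZ hW x => ⟨h.ip_curvature_skew hcov hX hY hZ hW x,
        h.curvature_ξ hcov hX hY x, h.curvature_ap hcov hX hY hZ x⟩,
      fun X Y Z W hX hY hZ _ x => h.ip_curvature hcov hX hY hZ W x,
      fun _ _ β _ Z W hZ _ x => h.curvatureOperator_eq hcov hZ W β x,
      h.ricci_eq hcov, h.exists_parallel_spinors hcov⟩⟩
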